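/- Let $T$ be an increasing tree on $[n]=\{1,\dots,n\}$: a directed graph whose underlying undirected graph is a tree and all of whose edges $(u,v)$ satisfy $u<v$. Assume that $T$ is unstarred: there are no vertices $u,v$ such that $u$ has at least two incoming edges, $v$ has at least two outgoing edges, and there is a (possibly trivial) directed path from $u$ to $v$. (For instance, a rooted tree with all edges oriented toward the root is unstarred.) Notation. * Let $\mathrm{tc}(T)$ be the transitive closure of $T$. A reorientation $R$ of $\mathrm{tc}(T)$ is obtained by reversing a set $\mathrm{rev}(R)$ of its edges; $\mathrm{AReori}(\mathrm{tc}(T))$ is the set of reorientations without directed cycle, ordered by inclusion of the sets $\mathrm{rev}(R)$. * Let $\mathcal P(T)$ be the hypergraph formed by the vertex sets of the directed paths of $T$ (including one-vertex paths). A sourcing $S$ chooses $S(P)\in P$ for each $P\in\mathcal P(T)$; it is acyclic if the directed graph with edges $(h,S(P))$ for $h\in P\in\mathcal P(T)$, $h\neq S(P)$, has no directed cycle. $\mathrm{ASour}(\mathcal P(T))$ is the set of acyclic sourcings, ordered by $S\le S'$ iff $S(P)\le S'(P)$ for all $P$. Let $\mathrm{rev}(S)$ be the set of pairs $(u,v)$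 such that some directed path $P$ from $u$ to $v$ has $S(P)=v$. * An ornament of $T$ at $v$ is a set $U$ of vertices with $v\in U$ such that every $u\in U$ has a directed path to $v$ inside $U$. An ornamentation $O$ assigns to each vertex $v$ an ornament $O(v)$ at $v$ such that $u\in O(v)$ implies $O(u)\subseteq O(v)$. $\mathrm{Orn}(T)$ is the set of ornamentations, ordered by componentwise inclusion. * For a reorientation $R$ of $\mathrm{tc}(T)$ (resp. a sourcing $S$ of $\mathcal P(T)$), $\mathrm{orn}(R)$ (resp. $\mathrm{orn}(S)$) is the ornamentation sending $v$ to the inclusion maximal ornament at $v$ all of whose vertices have a directed path to $v$ in $\mathrm{rev}(R)$ (resp. $\mathrm{rev}(S)$). An ornamentation is acyclic if it equals $\mathrm{orn}(R)$ for some $R\in\mathrm{AReori}(\mathrm{tc}(T))$; $\mathrm{AOrn}(T)\subseteq\mathrm{Orn}(T)$ is the subposet of acyclic ornamentations. * $\Delta_{\mathcal P(T)}=\sum_{P\in\mathcal P(T)}\mathrm{conv}\{e_h : h\in P\}\subset\mathbb R^n$ (Minkowski sum), and $\omega=(n-1,n-3,\dots,3-n,1-n)$. Then: 1. $\mathrm{AReori}(\mathrm{tc}(T))$,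 $\mathrm{ASour}(\mathcal P(T))$ and $\mathrm{AOrn}(T)$ are lattices. 2. Every ornamentation of $T$ is acyclic, so $\mathrm{AOrn}(T)=\mathrm{Orn}(T)$, and $S\mapsto\mathrm{orn}(S)$ is a poset isomorphism from $\mathrm{ASour}(\mathcal P(T))$ onto $\mathrm{AOrn}(T)=\mathrm{Orn}(T)$. 3. $\mathrm{Orn}(T)$ is a lattice, and $R\mapsto\mathrm{orn}(R)$ is a surjective map from $\mathrm{AReori}(\mathrm{tc}(T))$ to $\mathrm{Orn}(T)$ preserving joins and meets. Hence $\mathrm{Orn}(T)$ is the lattice quotient of $\mathrm{AReori}(\mathrm{tc}(T))$ by the lattice congruence whose classes are the fibers of this map. 4. $\mathrm{Orn}(T)$ is isomorphic to the (reflexive and) transitive closure of the graph (vertices and edges) of the polytope $\Delta_{\mathcal P(T)}$ oriented by $\omega$, where an edge with end points $x,y$ is oriented from $x$ to $y$ when $\langle\omega,x\rangle>\langle\omega,y\rangle$, and $x\le y$ means that there is a directed path from $x$ to $y$. -/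

import Mathlib

open scoped Pointwise

namespace Ornamentations

/-! ### Order-theoretic notions -/

/-- A partially ordered set is a lattice if any two elements have a join and a meet. -/
def IsLatticePoset (α : Type*) [PartialOrder α] : Prop :=
  ∀ a b : α, (∃ c, IsLUB {a, b} c) ∧ (∃ c, IsGLB {a, b} c)

/-- `f` sends joins to joins and meets to meets. -/
def IsLatticeMap {α β : Type*} [PartialOrder α] [PartialOrder β] (f : α → β) : Prop :=
  ∀ a b c : α, (IsLUB {a, b} c → IsLUB {f a, f b} (f c)) ∧
    (IsGLB {a, b} c → IsGLB {f a, f b} (f c))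

/-- A lattice congruence: an equivalence relation compatible with joins and meets. -/
def IsLatticeCongruence {α : Type*} [PartialOrder α] (s : Setoid α) : Prop :=
  ∀ a a' b b' c c' : α, s a a' → s b b' →
    (IsLUB {a, b} c → IsLUB {a', b'} c' → s c c') ∧
    (IsGLB {a, b} c → IsGLB {a', b'} c' → s c c')

/-- `f` presents `β` as the lattice quotient of `α` by the congruence whose classes are the
fibers of `f`; in the quotient order, a class `X` is below a class `Y` when some element of `X` is
below some element of `Y`. -/
def IsLatticeQuotientMap {α β : Type*} [PartialOrder α] [PartialOrder β] (f : α → β) : Prop :=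
  IsLatticeCongruence (Setoid.ker f) ∧
    ∃ e : Quotient (Setoid.ker f) ≃ β, (∀ a, e (Quotient.mk _ a) = f a) ∧
      ∀ X Y, e X ≤ e Y ↔ ∃ a b : α, Quotient.mk _ a = X ∧ Quotient.mk _ b = Y ∧ a ≤ b

/-! ### Directed graphs -/

section Graphs

variable {V : Type*}

/-- The directed graph with arrows `r` has no directed cycle. -/
def HasNoCycle (r : V → V → Prop) : Prop := ∀ v, ¬ Relation.TransGen r v v

/-- The transitive closure of a directed graph. -/
def tc (D : Digraph V) : Digraph V where
  Adj := Relation.TransGen D.Adj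

/-- An increasing tree: the underlying graph is a tree, and all arrows increase. -/
def IsIncreasingTree [LT V] (T : Digraph V) : Prop :=
  (∀ u v, T.Adj u v → u < v) ∧ T.toSimpleGraphInclusive.IsTree

/-- There are no `u`, `v` such that `u` has at least two incoming edges, `v` has at least two
outgoing edges, and there is a (possibly trivial) directed path from `u` to `v`. -/
def IsUnstarred (T : Digraph V) : Prop :=
  ¬ ∃ u v : V, (∃ a b, a ≠ b ∧ T.Adj a u ∧ T.Adj b u) ∧
    (∃ d e, d ≠ e ∧ T.Adj v d ∧ T.Adj v e) ∧ Relation.ReflTransGen T.Adj u v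

/-! ### Reorientations -/

/-- A reorientation of `E`, given by its set of reversed arrows; the order is inclusion. -/
abbrev Reori (E : Digraph V) : Type _ := {A : Set (V × V) // ∀ p ∈ A, E.Adj p.1 p.2}

/-- The arrows of `E` that are reversed in `R`. -/
def rev {E : Digraph V} (R : Reori E) (u v : V) : Prop := (u, v) ∈ R.1

/-- The directed graph obtained from `E` by reversing the arrows in `rev R`. -/
def reoriented {E : Digraph V} (R : Reori E) : Digraph V where
  Adj u v := (E.Adj u v ∧ ¬ rev R u v) ∨ rev R v u

/-- The poset of acyclic reorientations. -/
abbrev AReori (E : Digraph V) : Type _ := {R : Reori E // HasNoCycle (reoriented R).Adj}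

/-! ### Ornamentations -/

/-- `U` contains `v`, and any vertex of `U` has a directed path to `v` inside `U`. -/
def IsOrnament (D : Digraph V) (v : V) (U : Set V) : Prop :=
  v ∈ U ∧ ∀ u ∈ U, Relation.ReflTransGen (fun a b => a ∈ U ∧ b ∈ U ∧ D.Adj a b) u v

/-- The ornamentations of `D`, ordered by componentwise inclusion. -/
abbrev Orn (D : Digraph V) : Type _ :=
  {O : V → Set V // (∀ v, IsOrnament D v (O v)) ∧ ∀ u v, u ∈ O v → O u ⊆ O v}

/-- The inclusion maximal ornament of `D` at `v` all of whose vertices have a directed path to `v`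
in the directed graph with arrows `r` (see `isGreatest_maxOrnament`). -/
def maxOrnament (D : Digraph V) (r : V → V → Prop) (v : V) : Set V :=
  ⋃₀ {U | IsOrnament D v U ∧ ∀ u ∈ U, Relation.ReflTransGen r u v}

theorem IsOrnament.mono_path {D : Digraph V} {v u : V} {U W : Set V} (hU : IsOrnament D v U)
    (hUW : U ⊆ W) (hu : u ∈ U) :
    Relation.ReflTransGen (fun a b => a ∈ W ∧ b ∈ W ∧ D.Adj a b) u v :=
  Relation.ReflTransGen.mono
    (fun (a b : V) (h : a ∈ U ∧ b ∈ U ∧ D.Adj a b) =>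
      (⟨hUW h.1, hUW h.2.1, h.2.2⟩ : a ∈ W ∧ b ∈ W ∧ D.Adj a b)) _ _ (hU.2 u hu)

theorem isGreatest_maxOrnament (D : Digraph V) (r : V → V → Prop) (v : V) :
    IsGreatest {U | IsOrnament D v U ∧ ∀ u ∈ U, Relation.ReflTransGen r u v}
      (maxOrnament D r v) := by
  refine ⟨⟨⟨?_, ?_⟩, ?_⟩, fun U hU => Set.subset_sUnion_of_mem hU⟩
  · refine Set.mem_sUnion.2 ⟨{v}, ⟨⟨rfl, ?_⟩, ?_⟩, rfl⟩
    · rintro u rfl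
      exact Relation.ReflTransGen.refl
    · rintro u rfl
      exact Relation.ReflTransGen.refl
  · rintro u ⟨U, hU, hu⟩
    exact hU.1.mono_path (Set.subset_sUnion_of_mem hU) hu
  · rintro u ⟨U, hU, hu⟩
    exact hU.2 u hu

/-- The ornamentation that assigns to each vertex `v` the ornament `maxOrnament D r v`. -/
def ornOfRel (D : Digraph V) (r : V → V → Prop) : Orn D :=
  ⟨maxOrnament D r, fun v => (isGreatest_maxOrnament D r v).1.1, by
    intro u v huv
    obtain ⟨hv, hv'⟩ := (isGreatest_maxOrnament D r v).1
    obtain ⟨hu, hu'⟩ := (isGreatest_maxOrnament D r u).1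
    suffices h : maxOrnament D r u ∪ maxOrnament D r v ∈
        {U | IsOrnament D v U ∧ ∀ u ∈ U, Relation.ReflTransGen r u v} from
      Set.subset_union_left.trans ((isGreatest_maxOrnament D r v).2 h)
    refine ⟨⟨Or.inr hv.1, ?_⟩, ?_⟩
    · rintro w (hw | hw)
      · exact (hu.mono_path Set.subset_union_left hw).trans
          (hv.mono_path Set.subset_union_right huv)
      · exact hv.mono_path Set.subset_union_right hw
    · rintro w (hw | hw)
      · exact (hu' w hw).trans (hv' u huv)
      · exact hv' w hw⟩

/-- The ornamentation `orn(R)` of `D` associated to a reorientation `R` of `tc D`. -/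
def ornOfReori {D : Digraph V} (R : Reori (tc D)) : Orn D := ornOfRel D (rev R)

/-- An ornamentation is acyclic if it comes from an acyclic reorientation of `tc D`. -/
def IsAcyclicOrn {D : Digraph V} (O : Orn D) : Prop := ∃ R : AReori (tc D), ornOfReori R.1 = O

/-- The poset of acyclic ornamentations. -/
abbrev AOrn (D : Digraph V) : Type _ := {O : Orn D // IsAcyclicOrn O}

/-! ### Sourcings -/

/-- The sourcings of a hypergraph, ordered componentwise. -/
abbrev Sour [PartialOrder V] (ℋ : Finset (Finset V)) : Type _ :=
  {S : {H : Finset V // H ∈ ℋ} → V // ∀ H, S H ∈ H.1}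

/-- There is no directed cycle in the directed graph with an arrow from `h` to the source `S H`
for all hyperedges `H` and all vertices `h` of `H` distinct from `S H`. -/
def IsAcyclicSour [PartialOrder V] {ℋ : Finset (Finset V)} (S : Sour ℋ) : Prop :=
  HasNoCycle fun h s => ∃ H, h ∈ H.1 ∧ S.1 H = s ∧ h ≠ s

/-- The poset of acyclic sourcings. -/
abbrev ASour [PartialOrder V] (ℋ : Finset (Finset V)) : Type _ :=
  {S : Sour ℋ // IsAcyclicSour S}

/-- `P` is the vertex set of a directed path from `u` to `v` in `D`. -/
def IsPathSet [DecidableEq V] (D : Digraph V) (u v : V) (P : Finset V) : Prop :=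
  ∃ l : List V, l.IsChain D.Adj ∧ l.Nodup ∧ l.head? = some u ∧ l.getLast? = some v ∧
    l.toFinset = P

open Classical in
/-- The path hypergraph, formed by the vertex sets of all directed paths (including those with a
single vertex). -/
noncomputable def pathHypergraph [Fintype V] [DecidableEq V] (D : Digraph V) :
    Finset (Finset V) :=
  Finset.univ.filter fun P => ∃ u v, IsPathSet D u v P

/-- The pairs `(u, v)` such that some directed path from `u` to `v` has source `v`. -/
def revSour [Fintype V] [LinearOrder V] {D : Digraph V} (S : Sour (pathHypergraph D))
    (u v : V) : Prop :=
  ∃ P : {P : Finset V // P ∈ pathHypergraph D}, IsPathSet D u v P.1 ∧ S.1 P = v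

/-- The ornamentation `orn(S)` of `D` associated to a sourcing `S` of its path hypergraph. -/
def ornOfSour [Fintype V] [LinearOrder V] {D : Digraph V} (S : Sour (pathHypergraph D)) : Orn D :=
  ornOfRel D (revSour S)

end Graphs

/-! ### Hypergraphic polytopes -/

/-- The Minkowski sum over the hyperedges `H` of the simplices with vertices `e_h`, `h ∈ H`. -/
def hypergraphicPolytope {n : ℕ} (ℋ : Finset (Finset (Fin n))) : Set (Fin n → ℝ) :=
  ∑ H ∈ ℋ, convexHull ℝ ((fun h : Fin n => (Pi.single h 1 : Fin n → ℝ)) '' (H : Set (Fin n)))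

/-- The linear functional with coefficients `ω = (n - 1, n - 3, …, 3 - n, 1 - n)`. -/
def omega {n : ℕ} (x : Fin n → ℝ) : ℝ := ∑ i : Fin n, ((n : ℝ) - 1 - 2 * (i : ℝ)) * x i

/-- The vertices (zero-dimensional faces) of a polytope. -/
abbrev Vertices {n : ℕ} (Q : Set (Fin n → ℝ)) : Type := {x : Fin n → ℝ // x ∈ Q.exposedPoints ℝ}

/-- The segment joining the vertices `x` and `y` is an edge (a one-dimensional face) of `Q`, and
`ω` decreases from `x` to `y`. -/
def OrientedEdge {n : ℕ} (Q : Set (Fin n → ℝ)) (x y : Vertices Q) : Prop :=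
  x ≠ y ∧ IsExposed ℝ Q (segment ℝ x.1 y.1) ∧ omega y.1 < omega x.1

end Ornamentations

open Ornamentations

/-!
An acyclic reorientation `R` of the transitive closure of a directed tree is determined by its set
of reversed pairs, and this set is *biclosed*: transitive, with transitive complement
(`IsBiclosed`). The heart of the matter is the converse for unstarred trees
(`IsBiclosed.hasNoCycle`): the comparability graph is chordal, so an orientation without directed
triangles has no directed cycle. It is proved by induction on sets `W` of vertices. Call a vertex
upper if it is above a vertex with two incoming arrows; being unstarred means that the vertices
above an upper vertex form a chain, and the vertices below any other vertex always do. If an arrow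
`(b, a)` of the tree passes from a non-upper to an upper vertex and separates `W`, the comparable
pairs separated by it lie in the chain of vertices below `b` or above `a`, and cycles can be
shortcut to one side. Otherwise `W` has a vertex whose neighbours form a chain, which can be
removed.

As intervals are chains, the transitive closure of a union of biclosed sets is biclosed, and
complements of biclosed sets are biclosed, so the acyclic reorientations form a lattice. For an
ornamentation `O`, the reorientations `R` with `O ≤ orn R`, respectively `orn R ≤ O`, are those
containing the biclosed set `lowRel O`, respectively contained in the biclosed set `highRel O`.
Hence `orn` is a surjection with adjoints on both sides (`galoisConnection_low`,
`galoisConnection_high`), which gives the lattice quotient. An acyclic sourcing is recovered from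
its ornamentation, since the source of the path from `u` to `v` is its last vertex whose ornament
contains `u` (`IsAcyclicSour.source_spec`); sources of acyclic reorientations show surjectivity.

The vertices of the polytope are the points `∑ e_{S(P)}` for acyclic sourcings `S`. Along an edge
all sources that change do so in the same direction, so `ω` decreases along an edge only if the
sourcing increases (`le_of_orientedEdge`). Conversely, if `O < O'`, a single arrow can be flipped in
the largest reorientation with ornamentation `O` while staying below the largest one with
ornamentation `O'` (`exists_flip`). This changes the ornamentation, and it is an edge of the
polytope, because some linear functional is constant on the flipped pair and decreases along all
other arrows (`orientedEdge_of_flip`).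
-/

namespace Ornamentations

open Relation

/-! ### The reachability order of an increasing tree -/

section Tree

variable {V : Type*}

/-- `v` is reachable from `u` by a possibly trivial directed path. -/
abbrev Le (D : Digraph V) (u v : V) : Prop := ReflTransGen D.Adj u v

/-- `v` is reachable from `u` by a nontrivial directed path. -/
abbrev Lt (D : Digraph V) (u v : V) : Prop := TransGen D.Adj u v

theorem le_iff_eq_or_lt {D : Digraph V} {u v : V} : Le D u v ↔ u = v ∨ Lt D u v := by
  rw [Le, reflTransGen_iff_eq_or_transGen, eq_comm]

/-- Two vertices are comparable if a directed path joins them, in one direction or the other. -/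
def Comparable (D : Digraph V) (u v : V) : Prop := u = v ∨ Lt D u v ∨ Lt D v u

theorem comparable_of_le_or_le {D : Digraph V} {u v : V} (h : Le D u v ∨ Le D v u) :
    Comparable D u v := by
  simp only [le_iff_eq_or_lt] at h
  unfold Comparable
  tauto

/-- The properties of the reachability relation of a directed tree on which everything else rests:
there is no directed cycle, and removing the arrow `(b, a)` leaves a part that contains `b` but not
`a`, is closed under predecessors, and which only the arrow `(b, a)` leaves. -/
structure HasCuts (D : Digraph V) : Prop where
  irrefl : ∀ v, ¬ Lt D v v
  cut : ∀ b a, D.Adj b a → ∃ X : Set V, b ∈ X ∧ a ∉ X ∧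
    (∀ u v, D.Adj u v → v ∈ X → u ∈ X) ∧ ∀ u v, D.Adj u v → u ∈ X → v ∉ X → u = b ∧ v = a

theorem lt_of_transGen [Preorder V] {D : Digraph V} (h : ∀ u v, D.Adj u v → u < v) {u v : V}
    (huv : Lt D u v) : u < v := by
  induction huv with
  | single h' => exact h _ _ h'
  | tail _ h' ih => exact ih.trans (h _ _ h')

/-- Every edge of a tree is a bridge; the part to be left is the component of `b` once the edge
`{b, a}` is removed. -/
theorem IsIncreasingTree.hasCuts [Preorder V] {D : Digraph V} (hD : IsIncreasingTree D) :
    HasCuts D := by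
  refine ⟨fun v hv => lt_irrefl _ (lt_of_transGen hD.1 hv), fun b a hba => ?_⟩
  have hadj : ∀ {u v}, D.Adj u v → D.toSimpleGraphInclusive.Adj u v := fun {u v} h => by
    rw [Digraph.toSimpleGraphInclusive, SimpleGraph.fromRel_adj]
    exact ⟨(hD.1 _ _ h).ne, Or.inl h⟩
  have hbr := SimpleGraph.isAcyclic_iff_forall_adj_isBridge.1 hD.2.isAcyclic (hadj hba)
  rw [SimpleGraph.isBridge_iff] at hbr
  have hstep : ∀ {u v}, D.Adj u v → ¬ (u = b ∧ v = a) →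
      (D.toSimpleGraphInclusive.deleteEdges {s(b, a)}).Adj u v := fun {u v} h hne => by
    rw [SimpleGraph.deleteEdges_adj]
    refine ⟨hadj h, fun h' => ?_⟩
    rcases Sym2.eq_iff.1 (Set.mem_singleton_iff.1 h') with h' | ⟨rfl, rfl⟩
    · exact hne h'
    · exact lt_asymm (hD.1 _ _ h) (hD.1 _ _ hba)
  refine ⟨{v | (D.toSimpleGraphInclusive.deleteEdges {s(b, a)}).Reachable b v},
    SimpleGraph.Reachable.refl _, hbr, fun u v h hv => ?_, fun u v h hu hv => ?_⟩
  · by_cases hne : u = b ∧ v = a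
    · rw [hne.2] at hv
      exact absurd hv hbr
    · exact SimpleGraph.Reachable.trans hv (hstep h hne).symm.reachable
  · by_contra hne
    exact hv (SimpleGraph.Reachable.trans hu (hstep h hne).reachable)

variable {D : Digraph V}

theorem mem_of_le_of_mem {X : Set V} (hX : ∀ u v, D.Adj u v → v ∈ X → u ∈ X) {u v : V}
    (h : Le D u v) (hv : v ∈ X) : u ∈ X := by
  induction h using ReflTransGen.head_induction_on with
  | refl => exact hv
  | head h _ ih => exact hX _ _ h ih

/-- A directed path leaving a part uses an arrow that leaves it. -/
theorem exists_crossing {X : Set V} {u v : V} (h : Le D u v) (hu : u ∈ X) (hv : v ∉ X) :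
    ∃ b a, D.Adj b a ∧ b ∈ X ∧ a ∉ X ∧ Le D u b ∧ Le D a v := by
  induction h using ReflTransGen.head_induction_on with
  | refl => exact absurd hu hv
  | @head x y h hyv ih =>
    by_cases hy : y ∈ X
    · obtain ⟨b, a, h1, h2, h3, h4, h5⟩ := ih hy
      exact ⟨b, a, h1, h2, h3, h4.head h, h5⟩
    · exact ⟨x, y, h, hu, hy, .refl, hyv⟩

theorem HasCuts.antisymm (hD : HasCuts D) {u v : V} (h : Le D u v) (h' : Le D v u) : u = v := by
  rcases le_iff_eq_or_lt.1 h with rfl | h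
  · rfl
  · exact absurd (TransGen.trans_left h h') (hD.irrefl u)

/-- Two arrows out of `u` that lead to a common vertex coincide. -/
theorem HasCuts.right_unique (hD : HasCuts D) {u a a' v : V} (h : D.Adj u a) (h' : D.Adj u a')
    (hv : Le D a v) (hv' : Le D a' v) : a = a' := by
  obtain ⟨X, hu, ha, hX, hX'⟩ := hD.cut u a h
  have hvX : v ∉ X := fun hvX => ha (mem_of_le_of_mem hX hv hvX)
  by_cases ha' : a' ∈ X
  · obtain ⟨b, c, hbc, hb, hc, hab, -⟩ := exists_crossing hv' ha' hvX
    obtain ⟨rfl, -⟩ := hX' b c hbc hb hc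
    exact absurd (TransGen.head' h' hab) (hD.irrefl _)
  · exact (hX' u a' h' hu ha').2.symm

/-- Intervals of the reachability order are chains. -/
theorem HasCuts.interval_chain (hD : HasCuts D) {u v w w' : V} (h1 : Le D u w) (h2 : Le D w v)
    (h3 : Le D u w') (h4 : Le D w' v) : Le D w w' ∨ Le D w' w := by
  induction h1 using ReflTransGen.head_induction_on with
  | refl => exact Or.inl h3
  | @head x y hxy hyw ih =>
    rcases ReflTransGen.cases_head h3 with rfl | ⟨z, hxz, hzw'⟩
    · exact Or.inr (hyw.head hxy)
    · obtain rfl := hD.right_unique hxy hxz (hyw.trans h2) (hzw'.trans h4)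
      exact ih hzw'

/-- Two paths from `x` lead to comparable vertices, unless some vertex above `x` branches. -/
theorem exists_branching {r : V → V → Prop} {x y y' : V} (h : ReflTransGen r x y)
    (h' : ReflTransGen r x y') :
    (ReflTransGen r y y' ∨ ReflTransGen r y' y) ∨
      ∃ v d e, ReflTransGen r x v ∧ d ≠ e ∧ r v d ∧ r v e := by
  induction h using ReflTransGen.head_induction_on with
  | refl => exact Or.inl (Or.inl h')
  | @head x z hxz hzy ih =>
    rcases ReflTransGen.cases_head h' with rfl | ⟨z', hxz', hzy'⟩
    · exact Or.inl (Or.inr (hzy.head hxz))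
    · by_cases hz : z = z'
      · subst hz
        rcases ih hzy' with h | ⟨v, d, e, hv, h⟩
        · exact Or.inl h
        · exact Or.inr ⟨v, d, e, hv.head hxz, h⟩
      · exact Or.inr ⟨x, z, z', .refl, hz, hxz, hxz'⟩

/-- `x` is reachable from a vertex with at least two incoming arrows. -/
def IsUpper (D : Digraph V) (x : V) : Prop :=
  ∃ u a b, Le D u x ∧ a ≠ b ∧ D.Adj a u ∧ D.Adj b u

theorem IsUpper.mono {x y : V} (hx : IsUpper D x) (h : Le D x y) : IsUpper D y := by
  obtain ⟨u, a, b, hu, hab⟩ := hx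
  exact ⟨u, a, b, hu.trans h, hab⟩

/-- In an unstarred tree no vertex above an upper vertex branches. -/
theorem IsUnstarred.chain_above (hU : IsUnstarred D) {x y y' : V} (hx : IsUpper D x)
    (h : Le D x y) (h' : Le D x y') : Comparable D y y' := by
  rcases exists_branching h h' with h | ⟨v, d, e, hv, hde, hd, he⟩
  · exact comparable_of_le_or_le h
  · obtain ⟨u, a, b, hu, hab, ha, hb⟩ := hx
    exact absurd ⟨u, v, ⟨a, b, hab, ha, hb⟩, ⟨d, e, hde, hd, he⟩, hu.trans hv⟩ hU

theorem chain_below {x y y' : V} (hx : ¬ IsUpper D x)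
    (h : Le D y x) (h' : Le D y' x) : Comparable D y y' := by
  rcases exists_branching (reflTransGen_swap.2 h) (reflTransGen_swap.2 h') with
    h | ⟨v, d, e, hv, hde, hd, he⟩
  · exact comparable_of_le_or_le (h.symm.imp reflTransGen_swap.1 reflTransGen_swap.1)
  · exact absurd ⟨v, d, e, reflTransGen_swap.1 hv, hde, hd, he⟩ hx

end Tree

/-! ### Acyclic orientations of the comparability graph -/

section Biclosed

variable {V : Type*}

/-- The orientation of the graph of `lt` in which the pairs in `r` are reversed. -/
def Arr (lt r : V → V → Prop) (u v : V) : Prop := (lt u v ∧ ¬ r u v) ∨ r v u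

/-- A set of pairs `u < v` which is transitive and whose complement is transitive. -/
structure IsBiclosed (lt r : V → V → Prop) : Prop where
  sub : ∀ {u v}, r u v → lt u v
  closed : ∀ {u v w}, r u v → r v w → r u w
  coclosed : ∀ {u v w}, lt u v → lt v w → r u w → r u v ∨ r v w

/-- A failure of closedness or coclosedness is a directed triangle. -/
theorem isBiclosed_of_hasNoCycle {lt r : V → V → Prop}
    (htrans : ∀ {u v w}, lt u v → lt v w → lt u w) (hsub : ∀ u v, r u v → lt u v)
    (h : HasNoCycle (Arr lt r)) : IsBiclosed lt r := by
  refine ⟨hsub _ _, fun {u v w} huv hvw => ?_, fun {u v w} huv hvw huw => ?_⟩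
  · by_contra huw
    exact h u (.tail (.tail (.single (Or.inl ⟨htrans (hsub _ _ huv) (hsub _ _ hvw), huw⟩))
      (Or.inr hvw)) (Or.inr huv))
  · by_contra hno
    rw [not_or] at hno
    exact h u (.tail (.tail (.single (Or.inl ⟨huv, hno.1⟩)) (Or.inl ⟨hvw, hno.2⟩)) (Or.inr huw))

variable {D : Digraph V} {r : V → V → Prop}

theorem Arr.comparable (hr : IsBiclosed (Lt D) r) {x y : V} (h : Arr (Lt D) r x y) :
    Comparable D x y := by
  rcases h with h | h
  · exact Or.inr (Or.inl h.1)
  · exact Or.inr (Or.inr (hr.sub h))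

theorem HasCuts.arr_asymm (hD : HasCuts D) (hr : IsBiclosed (Lt D) r) {x y : V}
    (h : Arr (Lt D) r x y) (h' : Arr (Lt D) r y x) : False := by
  rcases h with h | h <;> rcases h' with h' | h'
  · exact hD.irrefl _ (h.1.trans h'.1)
  · exact h.2 h'
  · exact h'.2 h
  · exact hD.irrefl _ ((hr.sub h).trans (hr.sub h'))

theorem arr_total {x y : V} (h : Comparable D x y) :
    x = y ∨ Arr (Lt D) r x y ∨ Arr (Lt D) r y x := by
  unfold Arr
  rcases h with h | h | h
  · exact Or.inl h
  · by_cases h' : r x y <;> tauto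
  · by_cases h' : r y x <;> tauto

/-- Biclosed sets orient every chain transitively. -/
theorem HasCuts.arr_trans (hD : HasCuts D) (hr : IsBiclosed (Lt D) r) {x y z : V}
    (hxy : Arr (Lt D) r x y) (hyz : Arr (Lt D) r y z) (hxz : Comparable D x z) :
    Arr (Lt D) r x z := by
  have t : ∀ {u v w}, Lt D u v → Lt D v w → Lt D u w := fun h h' => h.trans h'
  have i := hD.irrefl
  have h1 := @IsBiclosed.sub _ _ _ hr
  have h2 := @IsBiclosed.closed _ _ _ hr
  have h3 := @IsBiclosed.coclosed _ _ _ hr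
  rcases arr_total (r := r) hxz with rfl | h | h
  · exact (hD.arr_asymm hr hxy hyz).elim
  · exact h
  · exfalso
    rcases hxy with ⟨a, a'⟩ | a <;> rcases hyz with ⟨b, b'⟩ | b <;> rcases h with ⟨c, c'⟩ | c
    · exact i _ (t (t a b) c)
    · rcases h3 a b c with h | h
      · exact a' h
      · exact b' h
    · rcases h3 c a b with h | h
      · exact c' h
      · exact a' h
    · exact a' (h2 c b)
    · rcases h3 b c a with h | h
      · exact b' h
      · exact c' h
    · exact b' (h2 a c)
    · exact c' (h2 b a)
    · exact i _ (t (t (h1 a) (h1 c)) (h1 b))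

/-- `ArrOn lt r W` is the part of the orientation inside `W`. -/
def ArrOn (lt r : V → V → Prop) (W : Set V) (u v : V) : Prop := u ∈ W ∧ v ∈ W ∧ Arr lt r u v

/-- A vertex whose neighbours are pairwise comparable lies on no shortest cycle, so it can be
removed. -/
theorem HasCuts.hasNoCycle_of_simplicial (hD : HasCuts D) (hr : IsBiclosed (Lt D) r) {W : Set V}
    {z : V} (hz : ∀ x ∈ W, ∀ y ∈ W, Comparable D z x → Comparable D z y → Comparable D x y)
    (h : HasNoCycle (ArrOn (Lt D) r (W \ {z}))) : HasNoCycle (ArrOn (Lt D) r W) := by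
  have key : ∀ {u v}, u ≠ z → TransGen (ArrOn (Lt D) r W) u v →
      (v ≠ z → TransGen (ArrOn (Lt D) r (W \ {z})) u v) ∧
      (v = z → ∃ w ∈ W, w ≠ z ∧ Arr (Lt D) r w z ∧
        ReflTransGen (ArrOn (Lt D) r (W \ {z})) u w) := by
    intro u v hu huv
    induction huv with
    | single huv =>
      refine ⟨fun hv => .single ⟨⟨huv.1, hu⟩, ⟨huv.2.1, hv⟩, huv.2.2⟩, ?_⟩
      rintro rfl
      exact ⟨u, huv.1, hu, huv.2.2, .refl⟩
    | @tail x v _ hxv ih =>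
      by_cases hx : x = z
      · obtain ⟨w, hw, hwz, hwx, huw⟩ := ih.2 hx
        subst hx
        refine ⟨fun hv => ?_, ?_⟩
        · have hwv := hD.arr_trans hr hwx hxv.2.2 (hz w hw v hxv.2.1
            (by have := hwx.comparable hr; unfold Comparable at *; tauto) (hxv.2.2.comparable hr))
          exact TransGen.tail' huw ⟨⟨hw, hwz⟩, ⟨hxv.2.1, hv⟩, hwv⟩
        · rintro rfl
          exact (hD.arr_asymm hr hxv.2.2 hxv.2.2).elim
      · have hux := ih.1 hx
        refine ⟨fun hv => hux.tail ⟨⟨hxv.1, hx⟩, ⟨hxv.2.1, hv⟩, hxv.2.2⟩, ?_⟩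
        rintro rfl
        exact ⟨x, hxv.1, hx, hxv.2.2, hux.to_reflTransGen⟩
  have hne : ∀ u, u ≠ z → ¬ TransGen (ArrOn (Lt D) r W) u u := fun u hu hcyc =>
    h u ((key hu hcyc).1 hu)
  intro u hcyc
  by_cases hu : u = z
  · subst hu
    obtain ⟨y, huy, hyu⟩ := TransGen.head'_iff.1 hcyc
    refine hne y ?_ (TransGen.tail' hyu huy)
    rintro rfl
    exact hD.arr_asymm hr huy.2.2 huy.2.2
  · exact hne u hu hcyc

/-- If the endpoints of the arrows between `X` and its complement are pairwise comparable, a cycle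
in `W` can be shortcut to one side. -/
theorem HasCuts.hasNoCycle_of_clique_cut (hD : HasCuts D) (hr : IsBiclosed (Lt D) r)
    {W X K : Set V} (hK : ∀ x ∈ K, ∀ y ∈ K, Comparable D x y)
    (hX : ∀ x y, Arr (Lt D) r x y → ¬ (x ∈ X ↔ y ∈ X) → x ∈ K ∧ y ∈ K)
    (h : ∀ c : Prop, HasNoCycle (ArrOn (Lt D) r (W ∩ {x | x ∈ X ↔ c}))) :
    HasNoCycle (ArrOn (Lt D) r W) := by
  have trans : ∀ {x y z}, x ∈ K → z ∈ K → (x = y ∨ Arr (Lt D) r x y) →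
      (y = z ∨ Arr (Lt D) r y z) → (x = z ∨ Arr (Lt D) r x z) := by
    rintro x y z hx hz (rfl | hxy) (rfl | hyz)
    · exact Or.inl rfl
    · exact Or.inr hyz
    · exact Or.inr hxy
    · exact Or.inr (hD.arr_trans hr hxy hyz (hK x hx z hz))
  -- inside one side, a path between two vertices of the clique can be replaced by an arrow
  have side : ∀ {x y}, x ∈ K → y ∈ K →
      ReflTransGen (ArrOn (Lt D) r (W ∩ {z | z ∈ X ↔ y ∈ X})) x y →
      (x = y ∨ Arr (Lt D) r x y) := by
    intro x y hx hy hxy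
    rcases reflTransGen_iff_eq_or_transGen.1 hxy with rfl | hxy'
    · exact Or.inl rfl
    · rcases arr_total (r := r) (hK x hx y hy) with h1 | h1 | h1
      · exact Or.inl h1
      · exact Or.inr h1
      · obtain ⟨z, hxz, -⟩ := TransGen.head'_iff.1 hxy'
        obtain ⟨z', -, hzy⟩ := TransGen.tail'_iff.1 hxy'
        exact (h _ _ (hxy'.tail ⟨hzy.2.1, hxz.1, h1⟩)).elim
  have key : ∀ {u v}, u ∈ K → u ∈ W → ReflTransGen (ArrOn (Lt D) r W) u v →
      ∃ k ∈ K, (u = k ∨ Arr (Lt D) r u k) ∧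
        ReflTransGen (ArrOn (Lt D) r (W ∩ {z | z ∈ X ↔ v ∈ X})) k v := by
    intro u v hu huW huv
    induction huv with
    | refl => exact ⟨u, hu, Or.inl rfl, .refl⟩
    | @tail x v _ hxv ih =>
      obtain ⟨k, hk, huk, hkx⟩ := ih
      by_cases hs : x ∈ X ↔ v ∈ X
      · refine ⟨k, hk, huk, ?_⟩
        rw [hs] at hkx
        exact hkx.tail ⟨⟨hxv.1, hs⟩, ⟨hxv.2.1, Iff.rfl⟩, hxv.2.2⟩
      · obtain ⟨hx, hv⟩ := hX x v hxv.2.2 hs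
        exact ⟨v, hv, trans hu hv (trans hu hx huk (side hk hx hkx)) (Or.inr hxv.2.2), .refl⟩
  -- a crossing arrow lies on no cycle
  have cross : ∀ {x y}, ArrOn (Lt D) r W x y → ¬ (x ∈ X ↔ y ∈ X) →
      ¬ ReflTransGen (ArrOn (Lt D) r W) y x := by
    intro x y hxy hs hyx
    obtain ⟨hx, hy⟩ := hX x y hxy.2.2 hs
    obtain ⟨k, hk, hyk, hkx⟩ := key hy hxy.2.1 hyx
    rcases trans hy hx hyk (side hk hx hkx) with rfl | h1
    · exact hs Iff.rfl
    · exact hD.arr_asymm hr hxy.2.2 h1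
  have split : ∀ {u v}, TransGen (ArrOn (Lt D) r W) u v →
      TransGen (ArrOn (Lt D) r (W ∩ {z | z ∈ X ↔ v ∈ X})) u v ∨
      ∃ x y, ReflTransGen (ArrOn (Lt D) r W) u x ∧ ArrOn (Lt D) r W x y ∧ ¬ (x ∈ X ↔ y ∈ X) ∧
        ReflTransGen (ArrOn (Lt D) r W) y v := by
    intro u v huv
    induction huv with
    | @single v h1 =>
      by_cases hs : u ∈ X ↔ v ∈ X
      · exact Or.inl (.single ⟨⟨h1.1, hs⟩, ⟨h1.2.1, Iff.rfl⟩, h1.2.2⟩)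
      · exact Or.inr ⟨u, v, .refl, h1, hs, .refl⟩
    | @tail x v hux h1 ih =>
      by_cases hs : x ∈ X ↔ v ∈ X
      · rcases ih with ih | ⟨y, z, h2, h3, h4, h5⟩
        · rw [hs] at ih
          exact Or.inl (ih.tail ⟨⟨h1.1, hs⟩, ⟨h1.2.1, Iff.rfl⟩, h1.2.2⟩)
        · exact Or.inr ⟨y, z, h2, h3, h4, h5.tail h1⟩
      · exact Or.inr ⟨x, v, hux.to_reflTransGen, h1, hs, .refl⟩
  intro u hcyc
  rcases split hcyc with h1 | ⟨x, y, h1, h2, h3, h4⟩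
  · exact h _ u h1
  · exact cross h2 h3 (h4.trans h1)

/-- In an unstarred tree, the orientation of the comparability graph given by a biclosed set is
acyclic. A set of vertices meeting both sides of an arrow `(b, a)` with `b` not upper and `a` upper
is cut along the clique formed by the vertices below `b` and above `a`; if there is no such arrow, a
minimal upper vertex or a maximal other vertex has pairwise comparable neighbours. -/
theorem IsBiclosed.hasNoCycle [Finite V] [LinearOrder V] (hinc : ∀ u v, D.Adj u v → u < v)
    (hD : HasCuts D) (hU : IsUnstarred D) (hr : IsBiclosed (Lt D) r) :
    HasNoCycle (Arr (Lt D) r) := by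
  suffices h : ∀ (k : ℕ) (W : Set V), W.ncard = k → HasNoCycle (ArrOn (Lt D) r W) by
    have h' : ArrOn (Lt D) r Set.univ = Arr (Lt D) r := by
      funext u v
      simp [ArrOn]
    exact h' ▸ h _ Set.univ rfl
  intro k
  induction k using Nat.strong_induction_on with
  | _ k ih =>
  intro W hWk
  have ih' : ∀ W' ⊂ W, HasNoCycle (ArrOn (Lt D) r W') := fun W' hW' =>
    ih _ (hWk ▸ Set.ncard_lt_ncard hW' (Set.toFinite _)) _ rfl
  by_cases hcross : ∃ x ∈ W, ∃ y ∈ W, Le D x y ∧ ¬ IsUpper D x ∧ IsUpper D y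
  · obtain ⟨x, hx, y, hy, hxy, hxu, hyu⟩ := hcross
    obtain ⟨b, a, hba, hb, ha, hxb, hay⟩ :=
      exists_crossing (X := {v | ¬ IsUpper D v}) hxy hxu (not_not.2 hyu)
    obtain ⟨X, hbX, haX, hX, hX'⟩ := hD.cut b a hba
    have hxX := mem_of_le_of_mem hX hxb hbX
    have hyX : y ∉ X := fun h => haX (mem_of_le_of_mem hX hay h)
    have hcr : ∀ {p q}, Le D p q → p ∈ X → q ∉ X → Le D p b ∧ Le D a q := by
      intro p q hpq hp hq
      obtain ⟨b', a', h1, h2, h3, h4, h5⟩ := exists_crossing hpq hp hq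
      obtain ⟨rfl, rfl⟩ := hX' _ _ h1 h2 h3
      exact ⟨h4, h5⟩
    refine hD.hasNoCycle_of_clique_cut hr (X := X) (K := {v | Le D v b ∨ Le D a v}) ?_ ?_ ?_
    · rintro p (hp | hp) q (hq | hq)
      · exact chain_below hb hp hq
      · exact comparable_of_le_or_le (Or.inl ((hp.tail hba).trans hq))
      · exact comparable_of_le_or_le (Or.inr ((hq.tail hba).trans hp))
      · exact hU.chain_above (not_not.1 ha) hp hq
    · intro p q hpq hs
      have hle : ∀ {p q}, Le D p q → ¬ (p ∈ X ↔ q ∈ X) → Le D p b ∧ Le D a q := by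
        intro p q h hs
        by_cases hp : p ∈ X
        · exact hcr h hp (by tauto)
        · exact absurd (mem_of_le_of_mem hX h (by tauto)) hp
      rcases hpq.comparable hr with rfl | h | h
      · exact absurd Iff.rfl hs
      · exact ⟨Or.inl (hle h.to_reflTransGen hs).1, Or.inr (hle h.to_reflTransGen hs).2⟩
      · have := hle h.to_reflTransGen (fun h => hs h.symm)
        exact ⟨Or.inr this.2, Or.inl this.1⟩
    · intro c
      refine ih' _ ⟨Set.inter_subset_left, fun hsub => ?_⟩
      have h1 := (hsub hx).2
      have h2 := (hsub hy).2
      simp only [Set.mem_ofPred_eq] at h1 h2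
      tauto
  · push Not at hcross
    by_cases hA : ∃ x ∈ W, IsUpper D x
    · obtain ⟨z, ⟨hzW, hzA⟩, hzmin⟩ := Set.exists_min_image {x | x ∈ W ∧ IsUpper D x} id
        (Set.toFinite _) hA
      have habove : ∀ x ∈ W, Comparable D z x → Le D z x := by
        rintro x hx (rfl | h | h)
        · exact .refl
        · exact h.to_reflTransGen
        · by_cases hxA : IsUpper D x
          · exact absurd (hzmin x ⟨hx, hxA⟩) (not_le.2 (lt_of_transGen hinc h))
          · exact absurd hzA (hcross x hx z hzW h.to_reflTransGen hxA)
      refine hD.hasNoCycle_of_simplicial hr (z := z) (fun x hx y hy hzx hzy =>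
        hU.chain_above hzA (habove x hx hzx) (habove y hy hzy)) (ih' _ ?_)
      exact Set.sdiff_singleton_ssubset.2 hzW
    · push Not at hA
      by_cases hne : W.Nonempty
      · obtain ⟨z, hzW, hzmax⟩ := Set.exists_max_image W id (Set.toFinite _) hne
        have hbelow : ∀ x ∈ W, Comparable D z x → Le D x z := by
          rintro x hx (rfl | h | h)
          · exact .refl
          · exact absurd (hzmax x hx) (not_le.2 (lt_of_transGen hinc h))
          · exact h.to_reflTransGen
        refine hD.hasNoCycle_of_simplicial hr (z := z) (fun x hx y hy hzx hzy =>
          chain_below (hA z hzW) (hbelow x hx hzx) (hbelow y hy hzy)) (ih' _ ?_)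
        exact Set.sdiff_singleton_ssubset.2 hzW
      · intro u hu
        obtain ⟨y, huy, -⟩ := TransGen.head'_iff.1 hu
        exact hne ⟨u, huy.1⟩

end Biclosed

/-! ### Maps with adjoints on both sides -/

section Adjoints

variable {α β : Type*} [PartialOrder α] [PartialOrder β] {f : α → β} {l u : β → α}

theorem isLatticeMap_of_adjoints (hl : GaloisConnection l f) (hu : GaloisConnection f u) :
    IsLatticeMap f := fun a b c =>
  ⟨fun h => by simpa [Set.image_pair] using hu.isLUB_l_image h,
    fun h => by simpa [Set.image_pair] using hl.isGLB_u_image h⟩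

/-- The fibers of a lattice map form a congruence. As the lower adjoint is a monotone section, two
comparable values of `f` have comparable preimages, so the quotient carries the order of `β`. -/
theorem isLatticeQuotientMap_of_adjoints (hl : GaloisConnection l f) (hu : GaloisConnection f u)
    (hf : ∀ b, f (l b) = b) : IsLatticeQuotientMap f := by
  have hmap := isLatticeMap_of_adjoints hl hu
  refine ⟨fun a a' b b' c c' ha hb => ⟨fun hc hc' => ?_, fun hc hc' => ?_⟩, ?_⟩
  · have h1 := (hmap a b c).1 hc
    have h2 := (hmap a' b' c').1 hc'
    rw [← Setoid.ker_def.1 ha, ← Setoid.ker_def.1 hb] at h2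
    exact Setoid.ker_def.2 (h1.unique h2)
  · have h1 := (hmap a b c).2 hc
    have h2 := (hmap a' b' c').2 hc'
    rw [← Setoid.ker_def.1 ha, ← Setoid.ker_def.1 hb] at h2
    exact Setoid.ker_def.2 (h1.unique h2)
  · refine ⟨Setoid.quotientKerEquivOfSurjective f fun b => ⟨l b, hf b⟩, fun a => rfl, ?_⟩
    intro X Y
    induction X using Quotient.inductionOn with | _ a => ?_
    induction Y using Quotient.inductionOn with | _ b => ?_
    change f a ≤ f b ↔ _
    refine ⟨fun h => ⟨l (f a), l (f b), Quotient.sound (Setoid.ker_def.2 (hf _)),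
      Quotient.sound (Setoid.ker_def.2 (hf _)), hl.monotone_l h⟩, ?_⟩
    rintro ⟨a', b', ha, hb, hab⟩
    rw [← Setoid.ker_def.1 (Quotient.exact ha), ← Setoid.ker_def.1 (Quotient.exact hb)]
    exact hl.monotone_u hab

theorem IsLatticePoset.of_surjective (h : IsLatticePoset α) (hf : IsLatticeMap f)
    (hs : Function.Surjective f) : IsLatticePoset β := by
  intro a b
  obtain ⟨a, rfl⟩ := hs a
  obtain ⟨b, rfl⟩ := hs b
  obtain ⟨⟨c, hc⟩, ⟨d, hd⟩⟩ := h a b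
  exact ⟨⟨f c, (hf a b c).1 hc⟩, ⟨f d, (hf a b d).2 hd⟩⟩

theorem IsLatticePoset.of_orderIso (h : IsLatticePoset α) (e : α ≃o β) : IsLatticePoset β :=
  h.of_surjective (isLatticeMap_of_adjoints e.symm.to_galoisConnection e.to_galoisConnection)
    e.surjective

end Adjoints

/-! ### The lattice of acyclic reorientations -/

section Reorientations

variable {V : Type*} {D : Digraph V} {r s : V → V → Prop}

/-- The two defining conditions of a biclosed set are exchanged by complementation. -/
theorem IsBiclosed.compl {lt : V → V → Prop} (htrans : ∀ {u v w}, lt u v → lt v w → lt u w)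
    (hr : IsBiclosed lt r) : IsBiclosed lt fun u v => lt u v ∧ ¬ r u v := by
  refine ⟨fun h => h.1, fun {u v w} huv hvw => ⟨htrans huv.1 hvw.1, fun h => ?_⟩,
    fun {u v w} huv hvw huw => ?_⟩
  · rcases hr.coclosed huv.1 hvw.1 h with h | h
    · exact huv.2 h
    · exact hvw.2 h
  · by_contra hno
    simp only [huv, hvw, true_and, not_or, not_not] at hno
    exact huw.2 (hr.closed hno.1 hno.2)

/-- The transitive closure of the union of two biclosed sets is biclosed. -/
theorem IsBiclosed.sup (hD : HasCuts D) (hr : IsBiclosed (Lt D) r) (hs : IsBiclosed (Lt D) s) :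
    IsBiclosed (Lt D) (TransGen fun u v => r u v ∨ s u v) := by
  have hlt : ∀ {u v}, TransGen (fun u v => r u v ∨ s u v) u v → Lt D u v := fun h => by
    induction h with
    | single h => exact h.elim hr.sub hs.sub
    | tail _ h ih => exact ih.trans (h.elim hr.sub hs.sub)
  have hco : ∀ {u v w}, Lt D u v → Lt D v w → (r u w ∨ s u w) →
      (r u v ∨ s u v) ∨ (r v w ∨ s v w) := by
    rintro u v w huv hvw (h | h)
    · exact (hr.coclosed huv hvw h).imp Or.inl Or.inl
    · exact (hs.coclosed huv hvw h).imp Or.inr Or.inr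
  refine ⟨hlt, fun h h' => h.trans h', fun {u v w} huv hvw huw => ?_⟩
  induction huw with
  | single h => exact (hco huv hvw h).imp .single .single
  | @tail x w hux hxw ih =>
    have hxw' : Lt D x w := hxw.elim hr.sub hs.sub
    rcases hD.interval_chain huv.to_reflTransGen hvw.to_reflTransGen
      (hlt hux).to_reflTransGen hxw'.to_reflTransGen with h | h
    · rcases le_iff_eq_or_lt.1 h with rfl | h
      · exact Or.inl hux
      · exact (ih h).imp id (fun h => h.tail hxw)
    · rcases le_iff_eq_or_lt.1 h with rfl | h
      · exact Or.inl hux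
      · exact (hco h hvw hxw).imp (fun h => hux.tail h) .single

/-- The reachability relation of `D` behaves as in a directed tree (`HasCuts`), and biclosed sets of
comparable pairs define acyclic reorientations. -/
structure IsVertebrate (D : Digraph V) : Prop extends HasCuts D where
  acyclic : ∀ {r}, IsBiclosed (Lt D) r → HasNoCycle (Arr (Lt D) r)

theorem IsIncreasingTree.isVertebrate [Finite V] [LinearOrder V] (hD : IsIncreasingTree D)
    (hU : IsUnstarred D) : IsVertebrate D :=
  ⟨hD.hasCuts, fun hr => hr.hasNoCycle hD.1 hD.hasCuts hU⟩

theorem AReori.isBiclosed (R : AReori (tc D)) : IsBiclosed (Lt D) (rev R.1) :=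
  isBiclosed_of_hasNoCycle (fun h h' => h.trans h') (fun u v h => R.1.2 (u, v) h) R.2

/-- The acyclic reorientation that reverses the pairs in a biclosed set. -/
def IsVertebrate.reori (hD : IsVertebrate D) (hr : IsBiclosed (Lt D) r) : AReori (tc D) :=
  ⟨⟨{p | r p.1 p.2}, fun _ hp => hr.sub hp⟩, hD.acyclic hr⟩

theorem areori_le_iff {R R' : AReori (tc D)} : R ≤ R' ↔ ∀ u v, rev R.1 u v → rev R'.1 u v :=
  ⟨fun h u v => @h (u, v), fun h p => h p.1 p.2⟩

theorem IsVertebrate.exists_isLUB (hD : IsVertebrate D) (a b : AReori (tc D)) :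
    ∃ c, IsLUB {a, b} c := by
  refine ⟨hD.reori (a.isBiclosed.sup hD.toHasCuts b.isBiclosed), ?_, fun c hc => ?_⟩
  · rintro x (rfl | rfl) <;> refine areori_le_iff.2 fun u v h => TransGen.single ?_
    · exact Or.inl h
    · exact Or.inr h
  · refine areori_le_iff.2 fun u v h => ?_
    replace h : TransGen (fun u v => rev a.1 u v ∨ rev b.1 u v) u v := h
    induction h with
    | single h =>
      exact h.elim (areori_le_iff.1 (hc (Or.inl rfl)) _ _)
        (areori_le_iff.1 (hc (Or.inr rfl)) _ _)
    | tail _ h ih =>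
      exact c.isBiclosed.closed ih (h.elim (areori_le_iff.1 (hc (Or.inl rfl)) _ _)
        (areori_le_iff.1 (hc (Or.inr rfl)) _ _))

/-- Reversing the arrows that were not reversed, and conversely. -/
def IsVertebrate.compl (hD : IsVertebrate D) (R : AReori (tc D)) : AReori (tc D) :=
  hD.reori (R.isBiclosed.compl fun h h' => h.trans h')

theorem IsVertebrate.compl_le_iff (hD : IsVertebrate D) {R R' : AReori (tc D)} :
    hD.compl R ≤ R' ↔ hD.compl R' ≤ R := by
  have key : ∀ {R R' : AReori (tc D)}, hD.compl R ≤ R' → hD.compl R' ≤ R := by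
    intro R R' h
    refine areori_le_iff.2 fun u v huv => ?_
    by_contra hR
    exact huv.2 (areori_le_iff.1 h u v ⟨huv.1, hR⟩)
  exact ⟨key, key⟩

theorem IsVertebrate.compl_compl (hD : IsVertebrate D) (R : AReori (tc D)) :
    hD.compl (hD.compl R) = R := by
  refine le_antisymm (hD.compl_le_iff.1 le_rfl) (areori_le_iff.2 fun u v h => ?_)
  exact ⟨R.isBiclosed.sub h, fun h' => h'.2 h⟩

theorem IsVertebrate.isLatticePoset_areori (hD : IsVertebrate D) :
    IsLatticePoset (AReori (tc D)) := by
  refine fun a b => ⟨hD.exists_isLUB a b, ?_⟩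
  obtain ⟨c, hc⟩ := hD.exists_isLUB (hD.compl a) (hD.compl b)
  refine ⟨hD.compl c, ?_, fun d hd => ?_⟩
  · rintro x (rfl | rfl)
    · exact hD.compl_le_iff.1 (hc.1 (Or.inl rfl))
    · exact hD.compl_le_iff.1 (hc.1 (Or.inr rfl))
  · have anti : ∀ {x}, d ≤ x → hD.compl x ≤ hD.compl d := fun {x} h =>
      hD.compl_le_iff.1 (by rwa [hD.compl_compl])
    rw [← hD.compl_compl d, hD.compl_le_iff, hD.compl_compl]
    refine hc.2 ?_
    rintro x (rfl | rfl)
    · exact anti (hd (Or.inl rfl))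
    · exact anti (hd (Or.inr rfl))

end Reorientations

/-! ### Ornamentations and the fibers of `orn` -/

section Ornaments

variable {V : Type*} {D : Digraph V}

theorem IsOrnament.le {u v : V} {U : Set V} (hU : IsOrnament D v U) (hu : u ∈ U) : Le D u v :=
  ReflTransGen.mono (fun _ _ h => h.2.2) _ _ (hU.2 u hu)

theorem IsOrnament.mem_of_le (hD : HasCuts D) {u v w : V} {U : Set V} (hU : IsOrnament D v U)
    (hu : u ∈ U) (huw : Le D u w) (hwv : Le D w v) : w ∈ U := by
  have h := hU.2 u hu
  induction h using ReflTransGen.head_induction_on with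
  | refl => exact hD.antisymm huw hwv ▸ hu
  | @head u x hux hxv ih =>
    rcases ReflTransGen.cases_head huw with rfl | ⟨z, huz, hzw⟩
    · exact hu
    · obtain rfl := hD.right_unique huz hux.2.2 (hzw.trans hwv) (hU.le hux.2.1)
      exact ih hux.2.1 hzw

theorem isOrnament_interval {u v : V} (huv : Le D u v) :
    IsOrnament D v {w | Le D u w ∧ Le D w v} := by
  refine ⟨⟨huv, .refl⟩, fun w hw => ?_⟩
  obtain ⟨huw, hwv⟩ := hw
  induction hwv using ReflTransGen.head_induction_on with
  | refl => exact .refl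
  | head h h' ih => exact (ih (huw.tail h)).head ⟨⟨huw, h'.head h⟩, ⟨huw.tail h, h'⟩, h⟩

/-- Since ornaments are closed under intervals, membership in the largest ornament is a condition on
the single path from `u` to `v`. -/
theorem HasCuts.mem_maxOrnament_iff (hD : HasCuts D) {r : V → V → Prop} {u v : V} :
    u ∈ maxOrnament D r v ↔
      Le D u v ∧ ∀ w, Le D u w → Le D w v → ReflTransGen r w v := by
  obtain ⟨⟨h1, h2⟩, h3⟩ := isGreatest_maxOrnament D r v
  refine ⟨fun h => ⟨h1.le h, fun w huw hwv => h2 w (h1.mem_of_le hD h huw hwv)⟩, fun h => ?_⟩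
  exact h3 ⟨isOrnament_interval h.1, fun w hw => h.2 w hw.1 hw.2⟩ ⟨.refl, h.1⟩

theorem Orn.le {O : Orn D} {u v : V} (h : u ∈ O.1 v) : Le D u v := (O.2.1 v).le h

theorem Orn.self_mem (O : Orn D) (v : V) : v ∈ O.1 v := (O.2.1 v).1

theorem Orn.mem_trans {O : Orn D} {u v w : V} (h : u ∈ O.1 v) (h' : v ∈ O.1 w) : u ∈ O.1 w :=
  O.2.2 v w h' h

theorem Orn.mem_of_le (hD : HasCuts D) {O : Orn D} {u v w : V} (h : u ∈ O.1 v) (huw : Le D u w)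
    (hwv : Le D w v) : w ∈ O.1 v :=
  (O.2.1 v).mem_of_le hD h huw hwv

theorem orn_le_iff {O O' : Orn D} : O ≤ O' ↔ ∀ u v, u ∈ O.1 v → u ∈ O'.1 v :=
  ⟨fun h _ v hu => h v hu, fun h v u hu => h u v hu⟩

/-- `u` is in the ornament of `v` when every vertex of the path from `u` to `v` other than `v` forms
a reversed pair with `v`. -/
theorem HasCuts.mem_ornOfReori_iff (hD : HasCuts D) (R : AReori (tc D)) {u v : V} :
    u ∈ (ornOfReori R.1).1 v ↔
      Le D u v ∧ ∀ w, Le D u w → Lt D w v → rev R.1 w v := by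
  have hR := R.isBiclosed
  have hgen : ∀ {w v}, TransGen (rev R.1) w v → rev R.1 w v := fun h => by
    induction h with
    | single h => exact h
    | tail _ h ih => exact hR.closed ih h
  refine hD.mem_maxOrnament_iff.trans
    ⟨fun h => ⟨h.1, fun w huw hwv => ?_⟩, fun h => ⟨h.1, fun w huw hwv => ?_⟩⟩
  · rcases reflTransGen_iff_eq_or_transGen.1 (h.2 w huw hwv.to_reflTransGen) with rfl | h
    · exact absurd hwv (hD.irrefl _)
    · exact hgen h
  · rcases le_iff_eq_or_lt.1 hwv with rfl | hwv
    · exact .refl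
    · exact .single (h.2 w huw hwv)

/-- The pairs reversed in the smallest acyclic reorientation with ornamentation `O`. -/
def lowRel (O : Orn D) (u v : V) : Prop := Lt D u v ∧ u ∈ O.1 v

/-- The pairs reversed in the largest acyclic reorientation with ornamentation `O`. -/
def highRel (O : Orn D) (u v : V) : Prop := ∃ w, Lt D u w ∧ Le D w v ∧ u ∈ O.1 w

theorem HasCuts.isBiclosed_lowRel (hD : HasCuts D) (O : Orn D) : IsBiclosed (Lt D) (lowRel O) :=
  ⟨fun h => h.1, fun h h' => ⟨h.1.trans h'.1, Orn.mem_trans h.2 h'.2⟩, fun huv hvw h =>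
    Or.inr ⟨hvw, Orn.mem_of_le hD h.2 huv.to_reflTransGen hvw.to_reflTransGen⟩⟩

/-- Coclosedness holds because the witness `w` of `highRel O` lies on a chain with the intermediate
vertex `v`: it is below `v`, or `v` belongs to the ornament of `w`. -/
theorem HasCuts.isBiclosed_highRel (hD : HasCuts D) (O : Orn D) :
    IsBiclosed (Lt D) (highRel O) := by
  refine ⟨?_, ?_, ?_⟩
  · rintro u v ⟨w, h1, h2, -⟩
    exact h1.trans_left h2
  · rintro u v w ⟨x, h1, h2, h3⟩ ⟨y, h4, h5, -⟩
    exact ⟨x, h1, h2.trans (h4.trans_left h5).to_reflTransGen, h3⟩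
  · rintro u v w huv hvw ⟨x, h1, h2, h3⟩
    rcases hD.interval_chain h1.to_reflTransGen h2 huv.to_reflTransGen
      hvw.to_reflTransGen with h | h
    · exact Or.inl ⟨x, h1, h, h3⟩
    · rcases le_iff_eq_or_lt.1 h with rfl | h
      · exact Or.inl ⟨v, h1, .refl, h3⟩
      · exact Or.inr ⟨x, h, h2, Orn.mem_of_le hD h3 huv.to_reflTransGen h.to_reflTransGen⟩

theorem HasCuts.wellFounded_lt [Finite V] (hD : HasCuts D) : WellFounded (Lt D) :=
  haveI : IsTrans V (Lt D) := ⟨fun _ _ _ h h' => h.trans h'⟩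
  haveI : Std.Irrefl (Lt D) := ⟨hD.irrefl⟩
  Finite.wellFounded_of_trans_of_irrefl _

theorem HasCuts.wellFounded_gt [Finite V] (hD : HasCuts D) :
    WellFounded (Function.swap (Lt D)) :=
  haveI : IsTrans V (Function.swap (Lt D)) := ⟨fun _ _ _ h h' => h'.trans h⟩
  haveI : Std.Irrefl (Function.swap (Lt D)) := ⟨hD.irrefl⟩
  Finite.wellFounded_of_trans_of_irrefl _

/-- `lowRel O` is contained in `rev R` exactly when `O ≤ orn R`. -/
theorem IsVertebrate.galoisConnection_low (hD : IsVertebrate D) :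
    GaloisConnection (fun O : Orn D => hD.reori (hD.isBiclosed_lowRel O))
      (fun R : AReori (tc D) => ornOfReori R.1) := by
  intro O R
  rw [areori_le_iff, orn_le_iff]
  refine ⟨fun h u v huv => (hD.mem_ornOfReori_iff R).2 ⟨Orn.le huv, fun w huw hwv => ?_⟩,
    fun h u v huv => ((hD.mem_ornOfReori_iff R).1 (h u v huv.2)).2 u .refl huv.1⟩
  exact h w v ⟨hwv, Orn.mem_of_le hD.toHasCuts huv huw hwv.to_reflTransGen⟩

/-- `orn R ≤ O` exactly when `rev R` is contained in `highRel O`. -/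
theorem IsVertebrate.galoisConnection_high [Finite V] (hD : IsVertebrate D) :
    GaloisConnection (fun R : AReori (tc D) => ornOfReori R.1)
      (fun O : Orn D => hD.reori (hD.isBiclosed_highRel O)) := by
  intro R O
  rw [areori_le_iff, orn_le_iff]
  constructor
  · -- the first `w` above `u` with `(u, w)` reversed has `u` in its ornament
    intro h u v huv
    obtain ⟨w, ⟨huw, hwv, hRw⟩, hmin⟩ := hD.wellFounded_lt.has_min
      {w | Lt D u w ∧ Le D w v ∧ rev R.1 u w} ⟨v, R.isBiclosed.sub huv, .refl, huv⟩
    refine ⟨w, huw, hwv, h u w ((hD.mem_ornOfReori_iff R).2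
      ⟨huw.to_reflTransGen, fun w' huw' hw'w => ?_⟩)⟩
    rcases le_iff_eq_or_lt.1 huw' with rfl | huw'
    · exact hRw
    · exact (R.isBiclosed.coclosed huw' hw'w hRw).resolve_left fun h' =>
        hmin w' ⟨huw', hw'w.to_reflTransGen.trans hwv, h'⟩ hw'w
  · intro h u v
    induction u using hD.wellFounded_gt.induction with
    | _ u ih =>
    intro huv
    have hu := (hD.mem_ornOfReori_iff R).1 huv
    rcases le_iff_eq_or_lt.1 hu.1 with rfl | huv'
    · exact Orn.self_mem O u
    · obtain ⟨w, huw, hwv, hw⟩ := h u v (hu.2 u .refl huv')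
      exact Orn.mem_trans hw
        (ih w huw (Orn.mem_of_le hD.toHasCuts huv huw.to_reflTransGen hwv))

theorem IsVertebrate.ornOfReori_low (hD : IsVertebrate D) (O : Orn D) :
    ornOfReori (hD.reori (hD.isBiclosed_lowRel O)).1 = O := by
  refine le_antisymm (orn_le_iff.2 fun u v h => ?_) ((hD.galoisConnection_low O _).1 le_rfl)
  have hu := (hD.mem_ornOfReori_iff _).1 h
  rcases le_iff_eq_or_lt.1 hu.1 with rfl | huv
  · exact Orn.self_mem O u
  · exact (hu.2 u .refl huv).2

theorem IsVertebrate.ornOfReori_high [Finite V] (hD : IsVertebrate D) (O : Orn D) :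
    ornOfReori (hD.reori (hD.isBiclosed_highRel O)).1 = O := by
  refine le_antisymm ((hD.galoisConnection_high _ O).2 le_rfl)
    ((hD.galoisConnection_low O _).1 (areori_le_iff.2 fun u v h => ?_))
  exact ⟨v, h.1, .refl, h.2⟩

end Ornaments

/-! ### Heights on acyclic directed graphs -/

section Heights

variable {V : Type*}

/-- On a finite acyclic directed graph, the number of proper ancestors is a height. -/
theorem exists_height [Finite V] {r : V → V → Prop} (h : HasNoCycle r) :
    ∃ f : V → ℕ, ∀ u v, r u v → f u < f v := by
  refine ⟨fun v => {u | TransGen r u v}.ncard,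
    fun u v huv => Set.ncard_lt_ncard ?_ (Set.toFinite _)⟩
  exact ⟨fun w hw => TransGen.tail hw huv, fun hsub => h u (hsub (TransGen.single huv))⟩

theorem hasNoCycle_of_height {α : Type*} [Preorder α] {r : V → V → Prop} (f : V → α)
    (h : ∀ u v, r u v → f u < f v) : HasNoCycle r := by
  have key : ∀ {u v}, TransGen r u v → f u < f v := fun huv => by
    induction huv with
    | single h' => exact h _ _ h'
    | tail _ h' ih => exact ih.trans (h _ _ h')
  exact fun v hv => lt_irrefl _ (key hv)

end Heights

/-! ### Acyclic sourcings of the path hypergraph -/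

section Sourcings

variable {V : Type*} [LinearOrder V] {D : Digraph V}

/-- The vertices of a directed path are those of the interval between its ends. -/
theorem isPathSet_iff (hinc : ∀ u v, D.Adj u v → u < v) (hD : HasCuts D) {u v : V}
    {P : Finset V} : IsPathSet D u v P ↔ Le D u v ∧ ∀ w, w ∈ P ↔ Le D u w ∧ Le D w v := by
  have key : ∀ (l : List V) (u : V), l.IsChain D.Adj → l.head? = some u → l.getLast? = some v →
      Le D u v ∧ ∀ w, w ∈ l ↔ Le D u w ∧ Le D w v := by
    intro l
    induction l with
    | nil => simp
    | cons x l ih =>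
      intro u hc hu hv
      obtain rfl : x = u := by simpa using hu
      cases l with
      | nil =>
        obtain rfl : x = v := by simpa using hv
        refine ⟨.refl, fun w => ?_⟩
        rw [List.mem_singleton]
        refine ⟨?_, fun h => hD.antisymm h.2 h.1⟩
        rintro rfl
        exact ⟨.refl, .refl⟩
      | cons y l =>
        rw [List.isChain_cons_cons] at hc
        obtain ⟨h1, h2⟩ := ih y hc.2 rfl (by simpa using hv)
        refine ⟨h1.head hc.1, fun w => ?_⟩
        rw [List.mem_cons, h2]
        constructor
        · rintro (rfl | h)
          · exact ⟨.refl, h1.head hc.1⟩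
          · exact ⟨h.1.head hc.1, h.2⟩
        · rintro ⟨hxw, hwv⟩
          rcases ReflTransGen.cases_head hxw with rfl | ⟨z, hxz, hzw⟩
          · exact Or.inl rfl
          · obtain rfl := hD.right_unique hxz hc.1 (hzw.trans hwv) h1
            exact Or.inr ⟨hzw, hwv⟩
  constructor
  · rintro ⟨l, hc, -, hu, hv, rfl⟩
    simpa using key l u hc hu hv
  · rintro ⟨huv, hP⟩
    obtain ⟨l, hc, hl⟩ := List.exists_isChain_cons_of_relationReflTransGen huv
    have h1 : (u :: l).getLast? = some v := by
      rw [List.getLast?_eq_some_getLast (List.cons_ne_nil _ _), hl]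
    refine ⟨u :: l, hc, ?_, rfl, h1, ?_⟩
    · exact ((hc.imp hinc).pairwise).imp ne_of_lt
    · ext w
      rw [List.mem_toFinset, (key _ u hc rfl h1).2, hP]

variable [Fintype V]

theorem mem_pathHypergraph_iff {P : Finset V} :
    P ∈ pathHypergraph D ↔ ∃ u v, IsPathSet D u v P := by
  simp [pathHypergraph]

theorem exists_isPathSet (hinc : ∀ u v, D.Adj u v → u < v) (hD : HasCuts D) {u v : V}
    (huv : Le D u v) : ∃ P : {P // P ∈ pathHypergraph D}, IsPathSet D u v P.1 := by
  classical
  have h : IsPathSet D u v (Finset.univ.filter fun w => Le D u w ∧ Le D w v) :=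
    (isPathSet_iff hinc hD).2 ⟨huv, by simp⟩
  exact ⟨⟨_, mem_pathHypergraph_iff.2 ⟨u, v, h⟩⟩, h⟩

/-- The arrows that have to be acyclic in an acyclic sourcing. -/
def SArr {ℋ : Finset (Finset V)} (S : Sour ℋ) (h s : V) : Prop :=
  ∃ H, h ∈ H.1 ∧ S.1 H = s ∧ h ≠ s

theorem reflTransGen_sarr (hinc : ∀ u v, D.Adj u v → u < v) (hD : HasCuts D)
    {S : Sour (pathHypergraph D)} {u v : V} (h : ReflTransGen (revSour S) u v) :
    ReflTransGen (SArr S) u v := by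
  induction h with
  | refl => exact .refl
  | @tail x y _ h ih =>
    obtain ⟨P, hP, rfl⟩ := h
    by_cases hx : x = S.1 P
    · exact hx ▸ ih
    · obtain ⟨h1, h2⟩ := (isPathSet_iff hinc hD).1 hP
      exact ih.tail ⟨P, (h2 x).2 ⟨.refl, h1⟩, rfl, hx⟩

/-- `u` is in the ornament of `v` when `v` is the source of every path to `v` that starts on the
path from `u` to `v`. -/
theorem IsAcyclicSour.mem_orn_iff (hinc : ∀ u v, D.Adj u v → u < v) (hD : HasCuts D)
    {S : Sour (pathHypergraph D)} (hS : IsAcyclicSour S) {u v : V} :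
    u ∈ (ornOfSour S).1 v ↔ Le D u v ∧ ∀ w P, Le D u w → IsPathSet D w v P.1 → S.1 P = v := by
  refine hD.mem_maxOrnament_iff.trans
    ⟨fun h => ⟨h.1, fun w P huw hP => ?_⟩, fun h => ⟨h.1, fun w huw hwv => ?_⟩⟩
  · obtain ⟨h1, h2⟩ := (isPathSet_iff hinc hD).1 hP
    obtain ⟨h3, h4⟩ := (h2 _).1 (S.2 P)
    by_contra hne
    exact hS v (TransGen.head' ⟨P, (h2 v).2 ⟨h1, .refl⟩, rfl, fun h => hne h.symm⟩
      (reflTransGen_sarr hinc hD (h.2 _ (huw.trans h3) h4)))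
  · obtain ⟨P, hP⟩ := exists_isPathSet hinc hD hwv
    exact .single ⟨P, hP, h.2 w P huw hP⟩

/-- The source of the path from `u` to `v` is the last vertex whose ornament contains `u`. -/
theorem IsAcyclicSour.source_spec (hinc : ∀ u v, D.Adj u v → u < v) (hD : HasCuts D)
    {S : Sour (pathHypergraph D)} (hS : IsAcyclicSour S) {u v : V}
    {P : {P // P ∈ pathHypergraph D}} (hP : IsPathSet D u v P.1) :
    u ∈ (ornOfSour S).1 (S.1 P) ∧
      ∀ w, Le D w v → u ∈ (ornOfSour S).1 w → Le D w (S.1 P) := by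
  obtain ⟨h1, h2⟩ := (isPathSet_iff hinc hD).1 hP
  obtain ⟨h3, h4⟩ := (h2 _).1 (S.2 P)
  constructor
  · refine (hS.mem_orn_iff hinc hD).2 ⟨h3, fun w P' huw hP' => ?_⟩
    obtain ⟨h5, h6⟩ := (isPathSet_iff hinc hD).1 hP'
    obtain ⟨h7, h8⟩ := (h6 _).1 (S.2 P')
    by_contra hne
    exact hS _ (.tail (.single ⟨P', (h6 _).2 ⟨h5, .refl⟩, rfl, fun h => hne h.symm⟩)
      ⟨P, (h2 _).2 ⟨huw.trans h7, h8.trans h4⟩, rfl, hne⟩)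
  · intro w hwv hw
    have huw := Orn.le hw
    rcases hD.interval_chain huw hwv h3 h4 with h | h
    · exact h
    · by_contra hne
      have hne' : w ≠ S.1 P := by
        rintro rfl
        exact hne .refl
      obtain ⟨P', hP'⟩ := exists_isPathSet hinc hD h
      have h5 := ((hS.mem_orn_iff hinc hD).1 hw).2 _ P' h3 hP'
      obtain ⟨h6, h7⟩ := (isPathSet_iff hinc hD).1 hP'
      exact hS w (.tail (.single ⟨P, (h2 w).2 ⟨huw, hwv⟩, rfl, hne'⟩)
        ⟨P', (h7 _).2 ⟨.refl, h⟩, h5, hne'.symm⟩)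

/-- By `IsAcyclicSour.source_spec`, an acyclic sourcing can be read off from its ornamentation, in
an order-preserving way. -/
theorem ornOfSour_le_iff (hinc : ∀ u v, D.Adj u v → u < v) (hD : HasCuts D)
    {S S' : Sour (pathHypergraph D)} (hS : IsAcyclicSour S) (hS' : IsAcyclicSour S') :
    ornOfSour S ≤ ornOfSour S' ↔ S ≤ S' := by
  have hmono : ∀ {u v}, Le D u v → u ≤ v := fun h => by
    rcases le_iff_eq_or_lt.1 h with rfl | h
    · exact le_rfl
    · exact (lt_of_transGen hinc h).le
  constructor
  · intro h P
    obtain ⟨u, v, hP⟩ := mem_pathHypergraph_iff.1 P.2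
    obtain ⟨-, h2⟩ := (isPathSet_iff hinc hD).1 hP
    exact hmono ((hS'.source_spec hinc hD hP).2 _ ((h2 _).1 (S.2 P)).2
      (orn_le_iff.1 h _ _ (hS.source_spec hinc hD hP).1))
  · refine fun h => orn_le_iff.2 fun u v hu => ?_
    obtain ⟨h1, h2⟩ := (hS.mem_orn_iff hinc hD).1 hu
    refine (hS'.mem_orn_iff hinc hD).2 ⟨h1, fun w P huw hP => ?_⟩
    obtain ⟨-, h4⟩ := (isPathSet_iff hinc hD).1 hP
    refine le_antisymm (hmono ((h4 _).1 (S'.2 P)).2) ?_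
    rw [← h2 w P huw hP]
    exact h P

/-- `S` chooses on each path the source of the orientation `R`. -/
def IsSourcingOf (S : Sour (pathHypergraph D)) (R : AReori (tc D)) : Prop :=
  ∀ P, ∀ h ∈ P.1, h ≠ S.1 P → Arr (Lt D) (rev R.1) (S.1 P) h

theorem exists_isSourcingOf (hinc : ∀ u v, D.Adj u v → u < v) (hD : HasCuts D)
    (R : AReori (tc D)) : ∃ S : ASour (pathHypergraph D), IsSourcingOf S.1 R := by
  obtain ⟨f, hf⟩ := exists_height (r := Arr (Lt D) (rev R.1)) R.2
  have hmin : ∀ P : {P // P ∈ pathHypergraph D}, ∃ s ∈ P.1, ∀ h ∈ P.1, f s ≤ f h := by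
    intro P
    obtain ⟨u, v, hP⟩ := mem_pathHypergraph_iff.1 P.2
    obtain ⟨h1, h2⟩ := (isPathSet_iff hinc hD).1 hP
    exact Finset.exists_min_image P.1 f ⟨u, (h2 u).2 ⟨.refl, h1⟩⟩
  -- heights increase along arrows, so the vertex of least height is the source
  choose s hs hsmin using hmin
  have harr : IsSourcingOf (⟨s, hs⟩ : Sour (pathHypergraph D)) R := by
    intro P h hh hne
    obtain ⟨u, v, hP⟩ := mem_pathHypergraph_iff.1 P.2
    obtain ⟨-, h2⟩ := (isPathSet_iff hinc hD).1 hP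
    have hc : Comparable D (s P) h := by
      obtain ⟨h3, h4⟩ := (h2 _).1 (hs P)
      obtain ⟨h5, h6⟩ := (h2 _).1 hh
      exact comparable_of_le_or_le (hD.interval_chain h3 h4 h5 h6)
    rcases arr_total (r := rev R.1) hc with h' | h' | h'
    · exact absurd h'.symm hne
    · exact h'
    · exact absurd (hf _ _ h') (not_lt.2 (hsmin P h hh))
  refine ⟨⟨⟨s, hs⟩, hasNoCycle_of_height (fun v => OrderDual.toDual (f v)) ?_⟩, harr⟩
  rintro h t ⟨P, hP, rfl, hne⟩
  exact hf _ _ (harr P h hP hne)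

/-- The ornamentation of a reorientation depends only on the sources of the paths. -/
theorem IsSourcingOf.ornOfSour_eq (hinc : ∀ u v, D.Adj u v → u < v) (hD : HasCuts D)
    {R : AReori (tc D)} {S : ASour (pathHypergraph D)} (h : IsSourcingOf S.1 R) :
    ornOfSour S.1 = ornOfReori R.1 := by
  have hR := R.isBiclosed
  refine le_antisymm (orn_le_iff.2 fun u v hu => ?_) (orn_le_iff.2 fun u v hu => ?_)
  · obtain ⟨h1, h2⟩ := (S.2.mem_orn_iff hinc hD).1 hu
    refine (hD.mem_ornOfReori_iff R).2 ⟨h1, fun w huw hwv => ?_⟩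
    obtain ⟨P, hP⟩ := exists_isPathSet hinc hD hwv.to_reflTransGen
    obtain ⟨h3, h4⟩ := (isPathSet_iff hinc hD).1 hP
    have hv := h2 w P huw hP
    have hne : w ≠ v := by
      rintro rfl
      exact hD.irrefl _ hwv
    rcases h P w ((h4 w).2 ⟨.refl, h3⟩) (hv ▸ hne) with h5 | h5
    · exact (hD.irrefl _ (hwv.trans (hv ▸ h5.1))).elim
    · exact hv ▸ h5
  · obtain ⟨h1, h2⟩ := (hD.mem_ornOfReori_iff R).1 hu
    refine (S.2.mem_orn_iff hinc hD).2 ⟨h1, fun w P huw hP => ?_⟩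
    obtain ⟨h3, h4⟩ := (isPathSet_iff hinc hD).1 hP
    obtain ⟨h5, h6⟩ := (h4 _).1 (S.1.2 P)
    rcases le_iff_eq_or_lt.1 h6 with h6 | h6
    · exact h6
    · have hne : v ≠ S.1.1 P := fun h' => hD.irrefl v (by rwa [← h'] at h6)
      exact (hD.arr_asymm hR (h P v ((h4 v).2 ⟨h3, .refl⟩) hne)
        (Or.inr (h2 _ (huw.trans h5) h6))).elim

theorem IsVertebrate.exists_ornOfSour_eq (hinc : ∀ u v, D.Adj u v → u < v)
    (hD : IsVertebrate D) (O : Orn D) : ∃ S : ASour (pathHypergraph D), ornOfSour S.1 = O := by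
  obtain ⟨S, hS⟩ := exists_isSourcingOf hinc hD.toHasCuts (hD.reori (hD.isBiclosed_lowRel O))
  exact ⟨S, (hS.ornOfSour_eq hinc hD.toHasCuts).trans (hD.ornOfReori_low O)⟩

/-- The isomorphism from acyclic sourcings to ornamentations. -/
noncomputable def IsVertebrate.sourEquiv (hinc : ∀ u v, D.Adj u v → u < v)
    (hD : IsVertebrate D) : ASour (pathHypergraph D) ≃o Orn D :=
  RelIso.ofSurjective (OrderEmbedding.ofMapLEIff
    (fun S : ASour (pathHypergraph D) => ornOfSour S.1)
    fun S S' => ornOfSour_le_iff hinc hD.toHasCuts S.2 S'.2) (hD.exists_ornOfSour_eq hinc)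

end Sourcings

/-! ### Flipping a single arrow -/

section Flips

variable {V : Type*} [Finite V] {D : Digraph V}

/-- Between two comparable acyclic reorientations, an arrow of the smaller one whose height
difference is minimal can be flipped on its own. -/
theorem IsVertebrate.exists_flip (hD : IsVertebrate D) {R R' : AReori (tc D)} (h : R < R') :
    ∃ a b, ¬ rev R.1 a b ∧ rev R'.1 a b ∧
      IsBiclosed (Lt D) fun u v => rev R.1 u v ∨ (u = a ∧ v = b) := by
  have hR := R.isBiclosed
  have hR' := R'.isBiclosed
  have hle := areori_le_iff.1 h.le
  obtain ⟨f, hf⟩ := exists_height (r := Arr (Lt D) (rev R.1)) R.2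
  have hne : {p : V × V | rev R'.1 p.1 p.2 ∧ ¬ rev R.1 p.1 p.2}.Nonempty := by
    by_contra hne
    refine h.not_ge (areori_le_iff.2 fun u v huv => ?_)
    by_contra hno
    exact hne ⟨(u, v), huv, hno⟩
  obtain ⟨⟨a, b⟩, ⟨hab', hab⟩, hmin⟩ := Set.exists_min_image _
    (fun p : V × V => (f p.2 : ℤ) - f p.1) (Set.toFinite _) hne
  simp only at hab hab'
  have hlt := hR'.sub hab'
  have hmin' : ∀ u v, rev R'.1 u v → ¬ rev R.1 u v → (f b : ℤ) - f a ≤ f v - f u :=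
    fun u v h1 h2 => hmin (u, v) ⟨h1, h2⟩
  refine ⟨a, b, hab, hab', ?_, ?_, ?_⟩
  · rintro u v (h1 | ⟨rfl, rfl⟩)
    · exact hR.sub h1
    · exact hlt
  · rintro u v w (h1 | ⟨rfl, rfl⟩) (h2 | ⟨h2, rfl⟩)
    · exact Or.inl (hR.closed h1 h2)
    · subst h2
      by_contra hno
      have h3 := hmin' u w (hR'.closed (hle _ _ h1) hab') fun h => hno (Or.inl h)
      have h4 := hf _ _ (Or.inr h1)
      omega
    · by_contra hno
      have h3 := hmin' u w (hR'.closed hab' (hle _ _ h2)) fun h => hno (Or.inl h)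
      have h4 := hf _ _ (Or.inr h2)
      omega
    · subst h2
      exact (hD.irrefl _ hlt).elim
  · rintro u v w huv hvw (h1 | ⟨rfl, rfl⟩)
    · exact (hR.coclosed huv hvw h1).imp Or.inl Or.inl
    · by_contra hno
      simp only [not_or] at hno
      have h3 := hf _ _ (Or.inl ⟨huv, hno.1.1⟩)
      have h4 := hf _ _ (Or.inl ⟨hvw, hno.2.1⟩)
      rcases hR'.coclosed huv hvw hab' with h5 | h5
      · have := hmin' _ _ h5 hno.1.1
        omega
      · have := hmin' _ _ h5 hno.2.1
        omega

end Flips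

/-! ### Vertices and edges of hypergraphic polytopes -/

section Polytopes

variable {n : ℕ} {ℋ : Finset (Finset (Fin n))}

/-- The basis vector `e_h`. -/
abbrev basisVec (h : Fin n) : Fin n → ℝ := Pi.single h 1

/-- The simplex with vertices `e_h` for `h ∈ H`. -/
abbrev hyperedgeSimplex (H : Finset (Fin n)) : Set (Fin n → ℝ) :=
  convexHull ℝ ((fun h : Fin n => (Pi.single h 1 : Fin n → ℝ)) '' (H : Set (Fin n)))

/-- The sum of the basis vectors of the sources. -/
noncomputable def sourPoint (S : Sour ℋ) : Fin n → ℝ := ∑ H, basisVec (S.1 H)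

theorem mem_hypergraphicPolytope_iff {y : Fin n → ℝ} : y ∈ hypergraphicPolytope ℋ ↔
    ∃ x : {H // H ∈ ℋ} → Fin n → ℝ, (∀ H, x H ∈ hyperedgeSimplex H.1) ∧ ∑ H, x H = y := by
  have h : hypergraphicPolytope ℋ = ∑ H : {H // H ∈ ℋ}, hyperedgeSimplex H.1 :=
    (Finset.sum_coe_sort ℋ hyperedgeSimplex).symm
  rw [h, Set.mem_finsetSum]
  constructor
  · rintro ⟨x, hx, hy⟩
    exact ⟨x, fun H => hx (Finset.mem_univ H), hy⟩
  · rintro ⟨x, hx, hy⟩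
    exact ⟨x, fun {H} _ => hx H, hy⟩

theorem basisVec_mem {H : Finset (Fin n)} {h : Fin n} (hh : h ∈ H) :
    basisVec h ∈ hyperedgeSimplex H :=
  subset_convexHull ℝ _ ⟨h, hh, rfl⟩

theorem sourPoint_mem (S : Sour ℋ) : sourPoint S ∈ hypergraphicPolytope ℋ :=
  mem_hypergraphicPolytope_iff.2 ⟨_, fun H => basisVec_mem (S.2 H), rfl⟩

theorem convex_hypergraphicPolytope : Convex ℝ (hypergraphicPolytope ℋ) := by
  intro x₀ hx₀ y₀ hy₀ a b ha hb hab
  obtain ⟨x, hx, rfl⟩ := mem_hypergraphicPolytope_iff.1 hx₀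
  obtain ⟨y, hy, rfl⟩ := mem_hypergraphicPolytope_iff.1 hy₀
  refine mem_hypergraphicPolytope_iff.2 ⟨fun H => a • x H + b • y H, fun H =>
    convex_convexHull ℝ _ (hx H) (hy H) ha hb hab, ?_⟩
  rw [Finset.sum_add_distrib, Finset.smul_sum, Finset.smul_sum]

theorem hyperedgeSimplex_spec {H : Finset (Fin n)} {x : Fin n → ℝ} (hx : x ∈ hyperedgeSimplex H) :
    (∀ i, 0 ≤ x i) ∧ (∀ i, i ∉ H → x i = 0) ∧ ∑ i, x i = 1 := by
  have hsub : hyperedgeSimplex H ⊆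
      {x | (∀ i, 0 ≤ x i) ∧ (∀ i, i ∉ H → x i = 0) ∧ ∑ i, x i = 1} := by
    refine convexHull_min ?_ ?_
    · rintro _ ⟨h, hh, rfl⟩
      refine ⟨fun i => ?_, fun i hi => ?_, by simp⟩
      · by_cases hi : i = h
        · subst hi
          simp
        · simp [hi]
      · have : i ≠ h := fun h' => hi (h' ▸ hh)
        simp [this]
    · rintro x ⟨h1, h2, h3⟩ y ⟨h4, h5, h6⟩ a b ha hb hab
      refine ⟨fun i => ?_, fun i hi => ?_, ?_⟩
      · exact add_nonneg (mul_nonneg ha (h1 i)) (mul_nonneg hb (h4 i))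
      · simp [h2 i hi, h5 i hi]
      · simp only [Pi.add_apply, Pi.smul_apply, smul_eq_mul, Finset.sum_add_distrib,
          ← Finset.mul_sum, h3, h6, mul_one, hab]
  exact hsub hx

theorem exists_dual (c : Fin n → ℝ) :
    ∃ l : StrongDual ℝ (Fin n → ℝ), ∀ x, l x = ∑ i, c i * x i := by
  refine ⟨∑ i, c i • ContinuousLinearMap.proj i, fun x => ?_⟩
  simp

theorem dual_apply (l : StrongDual ℝ (Fin n → ℝ)) (x : Fin n → ℝ) :
    l x = ∑ i, x i * l (basisVec i) := by
  conv_lhs => rw [pi_eq_sum_univ' x]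
  rw [map_sum]
  refine Finset.sum_congr rfl fun i _ => ?_
  rw [map_smul, smul_eq_mul]

variable {l : StrongDual ℝ (Fin n → ℝ)}

/-- The defect of `l` from `m`, as a weighted sum of its defects at the basis vectors. -/
theorem dual_gap {H : Finset (Fin n)} {x : Fin n → ℝ} (hx : x ∈ hyperedgeSimplex H) (m : ℝ) :
    m - l x = ∑ i, x i * (m - l (basisVec i)) := by
  simp only [mul_sub, Finset.sum_sub_distrib, ← Finset.sum_mul, (hyperedgeSimplex_spec hx).2.2,
    one_mul, ← dual_apply]

theorem dual_gap_nonneg {H : Finset (Fin n)} {x : Fin n → ℝ} (hx : x ∈ hyperedgeSimplex H) {m : ℝ}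
    (hm : ∀ h ∈ H, l (basisVec h) ≤ m) (i : Fin n) : 0 ≤ x i * (m - l (basisVec i)) := by
  obtain ⟨h1, h2, -⟩ := hyperedgeSimplex_spec hx
  by_cases hi : i ∈ H
  · exact mul_nonneg (h1 i) (sub_nonneg.2 (hm i hi))
  · simp [h2 i hi]

theorem dual_le {H : Finset (Fin n)} {x : Fin n → ℝ} (hx : x ∈ hyperedgeSimplex H) {m : ℝ}
    (hm : ∀ h ∈ H, l (basisVec h) ≤ m) : l x ≤ m := by
  rw [← sub_nonneg, dual_gap hx]
  exact Finset.sum_nonneg fun i _ => dual_gap_nonneg hx hm i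

/-- `l` is maximal on each hyperedge at the source chosen by `S`. -/
def IsMaxSour (l : StrongDual ℝ (Fin n → ℝ)) (S : Sour ℋ) : Prop :=
  ∀ H, ∀ h ∈ H.1, l (basisVec h) ≤ l (basisVec (S.1 H))

theorem IsMaxSour.le {S : Sour ℋ} (hS : IsMaxSour l S) {y : Fin n → ℝ}
    (hy : y ∈ hypergraphicPolytope ℋ) : l y ≤ l (sourPoint S) := by
  obtain ⟨x, hx, rfl⟩ := mem_hypergraphicPolytope_iff.1 hy
  rw [sourPoint, map_sum, map_sum]
  exact Finset.sum_le_sum fun H _ => dual_le (hx H) (hS H)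

/-- In a decomposition of a maximizer of `l`, each summand lies on the face of its simplex where `l`
is maximal. -/
theorem IsMaxSour.face {S : Sour ℋ} (hS : IsMaxSour l S) {x : {H // H ∈ ℋ} → Fin n → ℝ}
    (hx : ∀ H, x H ∈ hyperedgeSimplex H.1) (hl : l (sourPoint S) ≤ l (∑ H, x H))
    (H : {H // H ∈ ℋ}) (i : Fin n) (hi : x H i ≠ 0) :
    i ∈ H.1 ∧ l (basisVec i) = l (basisVec (S.1 H)) := by
  have h1 : ∀ H ∈ Finset.univ, l (x H) ≤ l (basisVec (S.1 H)) := fun H _ => dual_le (hx H) (hS H)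
  rw [sourPoint, map_sum, map_sum] at hl
  have h2 := (Finset.sum_eq_sum_iff_of_le h1).1 (le_antisymm (Finset.sum_le_sum h1) hl) H
    (Finset.mem_univ H)
  have h3 := dual_gap (l := l) (hx H) (l (basisVec (S.1 H)))
  rw [h2, sub_self, eq_comm, Finset.sum_eq_zero_iff_of_nonneg
    fun i _ => dual_gap_nonneg (hx H) (hS H) i] at h3
  refine ⟨?_, ?_⟩
  · by_contra hiH
    exact hi ((hyperedgeSimplex_spec (hx H)).2.1 i hiH)
  · exact (sub_eq_zero.1 ((mul_eq_zero.1 (h3 i (Finset.mem_univ i))).resolve_left hi)).symm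

theorem IsMaxSour.eq_basisVec {S : Sour ℋ} (hS : IsMaxSour l S) {x : {H // H ∈ ℋ} → Fin n → ℝ}
    (hx : ∀ H, x H ∈ hyperedgeSimplex H.1) (hl : l (sourPoint S) ≤ l (∑ H, x H))
    {H : {H // H ∈ ℋ}} (hH : ∀ h ∈ H.1, h ≠ S.1 H → l (basisVec h) < l (basisVec (S.1 H))) :
    x H = basisVec (S.1 H) := by
  have h0 : ∀ i, i ≠ S.1 H → x H i = 0 := fun i hi => by
    by_contra hne
    obtain ⟨h1, h2⟩ := hS.face hx hl H i hne
    exact (hH i h1 hi).ne h2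
  have h1 := (hyperedgeSimplex_spec (hx H)).2.2
  rw [Finset.sum_eq_single (S.1 H) (fun i _ hi => h0 i hi) (by simp)] at h1
  ext i
  by_cases hi : i = S.1 H
  · rw [hi, h1]
    simp
  · simp [h0 i hi, hi]

/-- An acyclic sourcing selects the strict maximum of some linear functional on each hyperedge. -/
theorem IsAcyclicSour.exists_dual {S : Sour ℋ} (hS : IsAcyclicSour S) :
    ∃ l : StrongDual ℝ (Fin n → ℝ), ∀ H, ∀ h ∈ H.1, h ≠ S.1 H →
      l (basisVec h) < l (basisVec (S.1 H)) := by
  obtain ⟨f, hf⟩ := exists_height hS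
  obtain ⟨l, hl⟩ := Ornamentations.exists_dual fun i => (f i : ℝ)
  have hl' : ∀ i, l (basisVec i) = f i := fun i => by simp [hl, Pi.single_apply]
  refine ⟨l, fun H h hh hne => ?_⟩
  rw [hl', hl']
  exact_mod_cast hf h (S.1 H) ⟨H, hh, rfl, hne⟩

theorem isMaxSour_of_lt {S : Sour ℋ}
    (h : ∀ H, ∀ h ∈ H.1, h ≠ S.1 H → l (basisVec h) < l (basisVec (S.1 H))) : IsMaxSour l S := by
  intro H i hi
  by_cases hne : i = S.1 H
  · rw [hne]
  · exact (h H i hi hne).le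

theorem IsAcyclicSour.mem_exposedPoints {S : Sour ℋ} (hS : IsAcyclicSour S) :
    sourPoint S ∈ (hypergraphicPolytope ℋ).exposedPoints ℝ := by
  obtain ⟨l, hl⟩ := hS.exists_dual
  have hmax := isMaxSour_of_lt hl
  refine ⟨sourPoint_mem S, l, fun y hy => ⟨hmax.le hy, fun hle => ?_⟩⟩
  obtain ⟨x, hx, rfl⟩ := mem_hypergraphicPolytope_iff.1 hy
  exact Finset.sum_congr rfl fun H _ => hmax.eq_basisVec hx hle (hl H)

theorem IsAcyclicSour.sourPoint_inj {S S' : Sour ℋ} (hS : IsAcyclicSour S)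
    (h : sourPoint S = sourPoint S') : S = S' := by
  obtain ⟨l, hl⟩ := hS.exists_dual
  refine Subtype.ext (funext fun H => ?_)
  have h1 := (isMaxSour_of_lt hl).eq_basisVec (x := fun H => basisVec (S'.1 H))
    (fun H => basisVec_mem (S'.2 H)) (h ▸ le_rfl) (hl H)
  by_contra hne
  have h2 := congrFun h1 (S.1 H)
  simp [hne] at h2

/-- The sourcing obtained by changing the source of one hyperedge. -/
def Sour.update (S : Sour ℋ) (H : {H // H ∈ ℋ}) (h : Fin n) (hh : h ∈ H.1) : Sour ℋ :=
  ⟨Function.update S.1 H h, fun H' => by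
    by_cases hH : H' = H
    · subst hH
      simpa using hh
    · simpa [hH] using S.2 H'⟩

theorem sourPoint_update (S : Sour ℋ) (H : {H // H ∈ ℋ}) (h : Fin n) (hh : h ∈ H.1) :
    sourPoint (S.update H h hh) = sourPoint S + (basisVec h - basisVec (S.1 H)) := by
  rw [← sub_eq_iff_eq_add', sourPoint, sourPoint, ← Finset.sum_sub_distrib,
    Finset.sum_eq_single H]
  · simp [Sour.update]
  · intro H' _ hne
    simp [Sour.update, hne]
  · simp

theorem isMaxSour_of_forall_le {S : Sour ℋ}
    (h : ∀ y ∈ hypergraphicPolytope ℋ, l y ≤ l (sourPoint S)) : IsMaxSour l S := by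
  intro H i hi
  have h1 := h _ (sourPoint_mem (S.update H i hi))
  rw [sourPoint_update, map_add, map_sub] at h1
  linarith

theorem exists_acyclicSour_of_mem_exposedPoints (hne : ∀ H ∈ ℋ, H.Nonempty) {x : Fin n → ℝ}
    (hx : x ∈ (hypergraphicPolytope ℋ).exposedPoints ℝ) :
    ∃ S : ASour ℋ, sourPoint S.1 = x := by
  obtain ⟨hxQ, l, hl⟩ := hx
  choose s hs hmax using fun H : {H // H ∈ ℋ} =>
    Finset.exists_max_image H.1 (fun h => l (basisVec h)) (hne H.1 H.2)
  let S : Sour ℋ := ⟨s, hs⟩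
  have hS : IsMaxSour l S := hmax
  have huniq : ∀ y ∈ hypergraphicPolytope ℋ, l (sourPoint S) ≤ l y → y = x := fun y hy hle =>
    (hl y hy).2 ((hS.le hxQ).trans hle)
  have hSx := huniq _ (sourPoint_mem S) le_rfl
  refine ⟨⟨S, hasNoCycle_of_height (fun i => l (basisVec i)) ?_⟩, hSx⟩
  rintro h t ⟨H, hH, rfl, hne⟩
  refine lt_of_le_of_ne (hS H h hH) fun heq => ?_
  -- a tie would give a second maximizer of `l`
  have h1 := sourPoint_update S H h hH
  have h2 : sourPoint (S.update H h hH) = x := by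
    refine huniq _ (sourPoint_mem _) ?_
    rw [h1, map_add, map_sub, heq]
    simp
  rw [h2, ← hSx, left_eq_add, sub_eq_zero] at h1
  have h3 := congrFun h1 h
  simp [hne] at h3

theorem omega_basisVec_le {a b : Fin n} :
    omega (basisVec a) ≤ omega (basisVec b) ↔ b ≤ a := by
  have h : ∀ a : Fin n, omega (basisVec a) = n - 1 - 2 * (a : ℝ) := fun a => by
    simp [omega, Pi.single_apply]
  rw [h, h, Fin.le_def, ← Nat.cast_le (α := ℝ)]
  constructor <;> intro h <;> linarith

/-- Along an edge of the polytope in the direction of decreasing `ω`, the sources increase. Changing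
a single source on the way from `S` to `S'` stays on the edge. -/
theorem le_of_orientedEdge {S S' : ASour ℋ} {x y : Vertices (hypergraphicPolytope ℋ)}
    (hx : x.1 = sourPoint S.1) (hy : y.1 = sourPoint S'.1)
    (h : OrientedEdge (hypergraphicPolytope ℋ) x y) : S ≤ S' := by
  obtain ⟨-, hexp, hω⟩ := h
  rw [hx, hy] at hexp hω
  obtain ⟨l, hl⟩ := hexp ⟨_, left_mem_segment ℝ _ _⟩
  have h1 := left_mem_segment ℝ (sourPoint S.1) (sourPoint S'.1)
  have h2 := right_mem_segment ℝ (sourPoint S.1) (sourPoint S'.1)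
  rw [hl] at h1 h2
  have hS := isMaxSour_of_forall_le h1.2
  have hS' := isMaxSour_of_forall_le h2.2
  intro H
  have heq : l (basisVec (S.1.1 H)) = l (basisVec (S'.1.1 H)) :=
    le_antisymm (hS' H _ (S.1.2 H)) (hS H _ (S'.1.2 H))
  have hz := sourPoint_update S.1 H _ (S'.1.2 H)
  have hlz : l (sourPoint (S.1.update H _ (S'.1.2 H))) = l (sourPoint S.1) := by
    rw [hz, map_add, map_sub, heq]
    simp
  have hmem : sourPoint (S.1.update H _ (S'.1.2 H)) ∈
      segment ℝ (sourPoint S.1) (sourPoint S'.1) := by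
    rw [hl]
    exact ⟨sourPoint_mem _, fun y hy => (h1.2 y hy).trans_eq hlz.symm⟩
  rw [segment_eq_image'] at hmem
  obtain ⟨t, ⟨ht, -⟩, ht'⟩ := hmem
  rw [hz] at ht'
  replace ht' := add_left_cancel ht'
  obtain ⟨w, hw⟩ := exists_dual fun i : Fin n => ((n : ℝ) - 1 - 2 * (i : ℝ))
  replace hw : ∀ x, omega x = w x := fun x => (hw x).symm
  change S.1.1 H ≤ S'.1.1 H
  rw [← omega_basisVec_le, hw, hw]
  rw [hw, hw] at hω
  have h3 := congrArg w ht'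
  rw [map_smul, map_sub, map_sub, smul_eq_mul] at h3
  nlinarith

/-- If some functional singles out, on every hyperedge, either the common source of `S` and `S'`, or
the pair `a < b` of their two sources, then `S` and `S'` span an edge. -/
theorem orientedEdge_of_tie {S S' : ASour ℋ} {x y : Vertices (hypergraphicPolytope ℋ)}
    (hx : x.1 = sourPoint S.1) (hy : y.1 = sourPoint S'.1) (hne : S ≠ S') {a b : Fin n}
    (hab : a < b) (htie : l (basisVec a) = l (basisVec b))
    (h : ∀ H, (S.1.1 H = S'.1.1 H ∧
        ∀ h ∈ H.1, h ≠ S.1.1 H → l (basisVec h) < l (basisVec (S.1.1 H))) ∨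
      (S.1.1 H = a ∧ S'.1.1 H = b ∧
        ∀ h ∈ H.1, h ≠ a → h ≠ b → l (basisVec h) < l (basisVec a))) :
    OrientedEdge (hypergraphicPolytope ℋ) x y := by
  have hmax : IsMaxSour l S.1 := by
    intro H i hi
    rcases h H with ⟨-, h1⟩ | ⟨h1, -, h2⟩
    · by_cases hi' : i = S.1.1 H
      · rw [hi']
      · exact (h1 i hi hi').le
    · rw [h1]
      by_cases hia : i = a
      · rw [hia]
      · by_cases hib : i = b
        · rw [hib, htie]
        · exact (h2 i hi hia hib).le
  have hpt : sourPoint S.1 ≠ sourPoint S'.1 := fun h' =>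
    hne (Subtype.ext (S.2.sourPoint_inj h'))
  classical
  -- `m` counts the hyperedges on which the source moves from `a` to `b`
  let δ : {H // H ∈ ℋ} → ℝ := fun H => if S.1.1 H = S'.1.1 H then 0 else 1
  have hδ : ∀ H, basisVec (S'.1.1 H) - basisVec (S.1.1 H) = δ H • (basisVec b - basisVec a) := by
    intro H
    by_cases hH : S.1.1 H = S'.1.1 H
    · simp [δ, hH]
    · rcases h H with ⟨h1, -⟩ | ⟨h1, h2, -⟩
      · exact absurd h1 hH
      · rw [h1, h2] at hH
        simp [δ, h1, h2, hH]
  have hδ0 : ∀ H, 0 ≤ δ H := fun H => by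
    by_cases hH : S.1.1 H = S'.1.1 H <;> simp [δ, hH]
  set m : ℝ := ∑ H, δ H with hm
  have hdiff : sourPoint S'.1 - sourPoint S.1 = m • (basisVec b - basisVec a) := by
    rw [sourPoint, sourPoint, ← Finset.sum_sub_distrib, hm, Finset.sum_smul]
    exact Finset.sum_congr rfl fun H _ => hδ H
  have hm0 : 0 < m := by
    refine lt_of_le_of_ne (Finset.sum_nonneg fun H _ => hδ0 H) fun h0 => hpt ?_
    rw [← h0, zero_smul, sub_eq_zero] at hdiff
    exact hdiff.symm
  have hS' : l (sourPoint S'.1) = l (sourPoint S.1) := by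
    rw [← sub_eq_zero, ← map_sub, hdiff, map_smul, map_sub, htie]
    simp
  refine ⟨fun h' => hpt (by rw [← hx, ← hy, h']), ?_, ?_⟩
  · intro _
    refine ⟨l, ?_⟩
    rw [hx, hy]
    ext z
    constructor
    · intro hz
      refine ⟨convex_hypergraphicPolytope.segment_subset (sourPoint_mem _) (sourPoint_mem _) hz,
        fun y hy => (hmax.le hy).trans_eq ?_⟩
      rw [segment_eq_image'] at hz
      obtain ⟨t, -, rfl⟩ := hz
      simp [hS']
    · rintro ⟨hz, hzmax⟩
      obtain ⟨x, hx, rfl⟩ := mem_hypergraphicPolytope_iff.1 hz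
      have hle := hzmax _ (sourPoint_mem S.1)
      have ht : ∀ H, ∃ t : ℝ, 0 ≤ t ∧ t ≤ δ H ∧
          x H - basisVec (S.1.1 H) = t • (basisVec b - basisVec a) := by
        intro H
        rcases h H with ⟨h1, h2⟩ | ⟨h1, h2, h3⟩
        · refine ⟨0, le_rfl, hδ0 H, ?_⟩
          rw [hmax.eq_basisVec hx hle h2, sub_self, zero_smul]
        · obtain ⟨h4, -, h6⟩ := hyperedgeSimplex_spec (hx H)
          have h0 : ∀ i, i ≠ a → i ≠ b → x H i = 0 := fun i hia hib => by
            by_contra hne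
            obtain ⟨h7, h8⟩ := hmax.face hx hle H i hne
            rw [h1] at h8
            exact (h3 i h7 hia hib).ne h8
          have hsum : x H a + x H b = 1 := by
            rw [← h6, ← Finset.sum_pair hab.ne]
            refine Finset.sum_subset (Finset.subset_univ _) fun i _ hi => ?_
            simp only [Finset.mem_insert, Finset.mem_singleton, not_or] at hi
            exact h0 i hi.1 hi.2
          refine ⟨x H b, h4 b, ?_, ?_⟩
          · have := h4 a
            simp only [δ, h1, h2, hab.ne, if_false]
            linarith
          · rw [h1]
            ext i
            by_cases hia : i = a
            · subst hia
              simp [hab.ne]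
              linarith
            · by_cases hib : i = b
              · subst hib
                simp [hia]
              · simp [h0 i hia hib, hia, hib]
      choose t ht0 ht1 ht using ht
      rw [segment_eq_image']
      refine ⟨(∑ H, t H) / m, ⟨div_nonneg (Finset.sum_nonneg fun H _ => ht0 H) hm0.le,
        (div_le_one hm0).2 (Finset.sum_le_sum fun H _ => ht1 H)⟩, ?_⟩
      simp only
      rw [hdiff, smul_smul, div_mul_cancel₀ _ hm0.ne', ← eq_sub_iff_add_eq', sourPoint,
        ← Finset.sum_sub_distrib, Finset.sum_smul]
      exact Finset.sum_congr rfl fun H _ => (ht H).symm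
  · obtain ⟨w, hw⟩ := exists_dual fun i : Fin n => ((n : ℝ) - 1 - 2 * (i : ℝ))
    replace hw : ∀ x, omega x = w x := fun x => (hw x).symm
    have h1 : omega (basisVec b) < omega (basisVec a) :=
      lt_of_not_ge fun h' => hab.not_ge (omega_basisVec_le.1 h')
    have h2 := congrArg w hdiff
    rw [map_smul, map_sub, map_sub, smul_eq_mul] at h2
    rw [hw, hw] at h1
    rw [hx, hy, hw, hw]
    nlinarith

end Polytopes

/-! ### Ornamentations as vertices of the path hypergraphic polytope -/

section PathPolytope

variable {n : ℕ} {T : Digraph (Fin n)}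

/-- Flipping the single arrow `(a, b)` moves along an edge of the polytope: a combination of heights
for the two orientations can be balanced to be equal at `a` and `b`, and it still decreases along
all other arrows. -/
theorem orientedEdge_of_flip (hinc : ∀ u v, T.Adj u v → u < v) (hT : HasCuts T)
    {R R' : AReori (tc T)} {a b : Fin n} (hab : Lt T a b) (hR : ¬ rev R.1 a b)
    (hR' : ∀ u v, rev R'.1 u v ↔ rev R.1 u v ∨ (u = a ∧ v = b))
    {S S' : ASour (pathHypergraph T)} (hS : IsSourcingOf S.1 R) (hS' : IsSourcingOf S'.1 R')
    (hne : S ≠ S') {x y : Vertices (hypergraphicPolytope (pathHypergraph T))}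
    (hx : x.1 = sourPoint S.1) (hy : y.1 = sourPoint S'.1) :
    OrientedEdge (hypergraphicPolytope (pathHypergraph T)) x y := by
  obtain ⟨f, hf⟩ := exists_height (r := Arr (Lt T) (rev R.1)) R.2
  obtain ⟨f', hf'⟩ := exists_height (r := Arr (Lt T) (rev R'.1)) R'.2
  have hfab : (f a : ℝ) < f b := by exact_mod_cast hf a b (Or.inl ⟨hab, hR⟩)
  have hfba : (f' b : ℝ) < f' a := by
    exact_mod_cast hf' b a (Or.inr ((hR' a b).2 (Or.inr ⟨rfl, rfl⟩)))
  -- the coefficients balance the two heights at `a` and `b`; the sign makes sources maximal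
  obtain ⟨l, hl⟩ := exists_dual fun i : Fin n =>
    -(((f' a : ℝ) - f' b) * f i + ((f b : ℝ) - f a) * f' i)
  have hl' : ∀ i, l (basisVec i) =
      -(((f' a : ℝ) - f' b) * f i + ((f b : ℝ) - f a) * f' i) := fun i => by
    simp [hl, Pi.single_apply]
  have harr : ∀ {u v}, Arr (Lt T) (rev R.1) u v → ¬ (u = a ∧ v = b) →
      Arr (Lt T) (rev R'.1) u v := by
    rintro u v (⟨h1, h2⟩ | h) hno
    · refine Or.inl ⟨h1, fun h => ((hR' u v).1 h).elim h2 hno⟩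
    · exact Or.inr ((hR' v u).2 (Or.inl h))
  have harr' : ∀ {u v}, Arr (Lt T) (rev R'.1) u v → ¬ (u = b ∧ v = a) →
      Arr (Lt T) (rev R.1) u v := by
    rintro u v (⟨h1, h2⟩ | h) hno
    · exact Or.inl ⟨h1, fun h => h2 ((hR' u v).2 (Or.inl h))⟩
    · exact Or.inr (((hR' v u).1 h).resolve_right fun h => hno h.symm)
  have hlt : ∀ {u v}, Arr (Lt T) (rev R.1) u v → ¬ (u = a ∧ v = b) →
      l (basisVec v) < l (basisVec u) := by
    intro u v h hno
    have h1 : (f u : ℝ) < f v := by exact_mod_cast hf u v h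
    have h2 : (f' u : ℝ) < f' v := by exact_mod_cast hf' u v (harr h hno)
    rw [hl', hl']
    nlinarith [mul_pos (sub_pos.2 hfba) (sub_pos.2 h1), mul_pos (sub_pos.2 hfab) (sub_pos.2 h2)]
  refine orientedEdge_of_tie hx hy hne (l := l) (lt_of_transGen hinc hab) ?_ fun P => ?_
  · rw [hl', hl']
    ring
  · by_cases heq : S.1.1 P = S'.1.1 P
    · refine Or.inl ⟨heq, fun h hh hne' => hlt (hS P h hh hne') ?_⟩
      rintro ⟨h1, rfl⟩
      have h2 := hS' P h hh (heq ▸ hne')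
      rw [← heq, h1] at h2
      exact hT.arr_asymm R'.isBiclosed h2 (Or.inr ((hR' a h).2 (Or.inr ⟨rfl, rfl⟩)))
    · have h1 := hS P _ (S'.1.2 P) fun h => heq h.symm
      have h2 := hS' P _ (S.1.2 P) heq
      have h3 : S'.1.1 P = b ∧ S.1.1 P = a := by
        by_contra hno
        exact hT.arr_asymm R.isBiclosed h1 (harr' h2 hno)
      refine Or.inr ⟨h3.2, h3.1, fun h hh hha hhb => ?_⟩
      rw [← h3.2] at hha
      have h4 := hlt (hS P h hh hha) fun h => hhb h.2
      rwa [h3.2] at h4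

/-- The bijection sending an acyclic sourcing to the corresponding vertex of the polytope. -/
noncomputable def IsVertebrate.vertexEquiv (hinc : ∀ u v, T.Adj u v → u < v)
    (hT : IsVertebrate T) :
    ASour (pathHypergraph T) ≃ Vertices (hypergraphicPolytope (pathHypergraph T)) :=
  Equiv.ofBijective (fun S => ⟨sourPoint S.1, S.2.mem_exposedPoints⟩) <| by
    refine ⟨fun S S' h => Subtype.ext (S.2.sourPoint_inj (congrArg Subtype.val h)), fun x => ?_⟩
    have hne : ∀ P ∈ pathHypergraph T, P.Nonempty := by
      intro P hP
      obtain ⟨u, v, hP⟩ := mem_pathHypergraph_iff.1 hP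
      obtain ⟨h1, h2⟩ := (isPathSet_iff hinc hT.toHasCuts).1 hP
      exact ⟨u, (h2 u).2 ⟨.refl, h1⟩⟩
    obtain ⟨S, hS⟩ := exists_acyclicSour_of_mem_exposedPoints hne x.2
    exact ⟨S, Subtype.ext hS⟩

/-- Above an ornamentation `O`, and below any given larger one, there is an ornamentation joined to
`O` by an edge of the polytope: flip a single arrow of the largest acyclic reorientation with
ornamentation `O`. -/
theorem IsVertebrate.exists_edge (hinc : ∀ u v, T.Adj u v → u < v) (hT : IsVertebrate T)
    {O O' : Orn T} (h : O < O') : ∃ O'', O < O'' ∧ O'' ≤ O' ∧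
      OrientedEdge (hypergraphicPolytope (pathHypergraph T))
        (hT.vertexEquiv hinc ((hT.sourEquiv hinc).symm O))
        (hT.vertexEquiv hinc ((hT.sourEquiv hinc).symm O'')) := by
  have hadj := hT.galoisConnection_high
  set R := hT.reori (hT.isBiclosed_highRel O) with hRdef
  set R' := hT.reori (hT.isBiclosed_highRel O') with hRdef'
  have hO : ornOfReori R.1 = O := hT.ornOfReori_high O
  have hO' : ornOfReori R'.1 = O' := hT.ornOfReori_high O'
  have hRR' : R < R' := by
    refine lt_of_le_of_ne (hadj.monotone_u h.le) fun heq => h.ne ?_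
    rw [← hO, ← hO', heq]
  obtain ⟨a, b, hab, hab', hcl⟩ := hT.exists_flip hRR'
  set R'' := hT.reori hcl with hRdef''
  have h1 : R ≤ R'' := areori_le_iff.2 fun u v h => Or.inl h
  have h2 : R'' ≤ R' := by
    refine areori_le_iff.2 fun u v h => ?_
    rcases (h : rev R.1 u v ∨ (u = a ∧ v = b)) with h | ⟨rfl, rfl⟩
    · exact areori_le_iff.1 hRR'.le u v h
    · exact hab'
  have h3 : O ≤ ornOfReori R''.1 := hO ▸ hadj.monotone_l h1
  have h4 : O ≠ ornOfReori R''.1 := fun heq =>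
    hab (areori_le_iff.1 ((hadj R'' O).1 heq.ge) a b (Or.inr ⟨rfl, rfl⟩))
  refine ⟨_, lt_of_le_of_ne h3 h4, hO' ▸ hadj.monotone_l h2, ?_⟩
  have hsource : ∀ R : AReori (tc T),
      IsSourcingOf ((hT.sourEquiv hinc).symm (ornOfReori R.1)).1 R := by
    intro R
    obtain ⟨S, hS⟩ := exists_isSourcingOf hinc hT.toHasCuts R
    have : (hT.sourEquiv hinc).symm (ornOfReori R.1) = S :=
      (hT.sourEquiv hinc).symm_apply_eq.2 (hS.ornOfSour_eq hinc hT.toHasCuts).symm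
    rwa [this]
  refine orientedEdge_of_flip hinc hT.toHasCuts (R'.isBiclosed.sub hab') hab (R' := R'')
    (fun u v => Iff.rfl) (hO ▸ hsource R) (hsource R'') (fun heq => h4 ?_) rfl rfl
  exact (hT.sourEquiv hinc).symm.injective heq

/-- The order of ornamentations is reachability along the oriented edges of the polytope. -/
theorem IsVertebrate.le_iff_reflTransGen (hinc : ∀ u v, T.Adj u v → u < v) (hT : IsVertebrate T)
    (O O' : Orn T) : O ≤ O' ↔ ReflTransGen
      (OrientedEdge (hypergraphicPolytope (pathHypergraph T)))
      (hT.vertexEquiv hinc ((hT.sourEquiv hinc).symm O))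
      (hT.vertexEquiv hinc ((hT.sourEquiv hinc).symm O')) := by
  constructor
  · intro h
    induction O using (wellFounded_gt (α := Orn T)).induction with
    | _ O ih =>
    rcases h.eq_or_lt with rfl | h
    · exact .refl
    · obtain ⟨O'', h1, h2, h3⟩ := hT.exists_edge hinc h
      exact .head h3 (ih O'' h1 h2)
  · intro h
    have key : ∀ x y : Vertices (hypergraphicPolytope (pathHypergraph T)),
        ReflTransGen (OrientedEdge (hypergraphicPolytope (pathHypergraph T))) x y →
        (hT.vertexEquiv hinc).symm x ≤ (hT.vertexEquiv hinc).symm y := by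
      intro x y hxy
      have hval : ∀ x, x.1 = sourPoint ((hT.vertexEquiv hinc).symm x).1 := fun x =>
        congrArg Subtype.val ((hT.vertexEquiv hinc).apply_symm_apply x).symm
      induction hxy with
      | refl => exact le_rfl
      | tail _ h ih => exact ih.trans (le_of_orientedEdge (hval _) (hval _) h)
    simpa using key _ _ h

end PathPolytope

end Ornamentations

theorem mainTheorem1 {n : ℕ} (T : Digraph (Fin n)) (hT : IsIncreasingTree T)
    (hU : IsUnstarred T) :
    -- the three acyclic posets are lattices
    (IsLatticePoset (AReori (tc T)) ∧ IsLatticePoset (ASour (pathHypergraph T)) ∧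
      IsLatticePoset (AOrn T)) ∧
    -- all ornamentations are acyclic, and `S ↦ orn(S)` is an isomorphism
    ((∀ O : Orn T, IsAcyclicOrn O) ∧
      (∃ e : ASour (pathHypergraph T) ≃o AOrn T, ∀ S, (e S).1 = ornOfSour S.1) ∧
      (∃ e : ASour (pathHypergraph T) ≃o Orn T, ∀ S, e S = ornOfSour S.1)) ∧
    -- `R ↦ orn(R)` is a surjective lattice map, and presents `Orn T` as a lattice quotient
    (IsLatticePoset (Orn T) ∧
      Function.Surjective (fun R : AReori (tc T) => ornOfReori R.1) ∧
      IsLatticeMap (fun R : AReori (tc T) => ornOfReori R.1) ∧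
      IsLatticeQuotientMap (fun R : AReori (tc T) => ornOfReori R.1)) ∧
    -- the transitive closure of the oriented graph of the path hypergraphic polytope
    (∃ φ : Orn T ≃ Vertices (hypergraphicPolytope (pathHypergraph T)), ∀ O O' : Orn T,
      O ≤ O' ↔ Relation.ReflTransGen
        (OrientedEdge (hypergraphicPolytope (pathHypergraph T))) (φ O) (φ O')) := by
  have hV := hT.isVertebrate hU
  have hacyc : ∀ O : Orn T, IsAcyclicOrn O := fun O => ⟨_, hV.ornOfReori_low O⟩
  let eA : Orn T ≃o AOrn T :=
    { toFun := fun O => ⟨O, hacyc O⟩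
      invFun := Subtype.val
      left_inv := fun _ => rfl
      right_inv := fun _ => rfl
      map_rel_iff' := Iff.rfl }
  let e : ASour (pathHypergraph T) ≃o Orn T := hV.sourEquiv hT.1
  have hlow := hV.galoisConnection_low
  have hhigh := hV.galoisConnection_high
  have hmap := isLatticeMap_of_adjoints hlow hhigh
  have hsurj : Function.Surjective (fun R : AReori (tc T) => ornOfReori R.1) := hacyc
  have hOrn := hV.isLatticePoset_areori.of_surjective hmap hsurj
  exact ⟨⟨hV.isLatticePoset_areori, hOrn.of_orderIso e.symm, hOrn.of_orderIso eA⟩,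
    ⟨hacyc, ⟨e.trans eA, fun _ => rfl⟩, ⟨e, fun _ => rfl⟩⟩,
    ⟨hOrn, hsurj, hmap, isLatticeQuotientMap_of_adjoints hlow hhigh hV.ornOfReori_low⟩,
    ⟨e.symm.toEquiv.trans (hV.vertexEquiv hT.1), hV.le_iff_reflTransGen hT.1⟩⟩
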